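/- Let $k$ be a field and $q\in k^{\times}$. Let $H_q$ be the bialgebra generated as an algebra by $D_1,D_2,\sigma^{\pm1}$ with relations $D_1D_2=D_2D_1$, $\sigma\sigma^{-1}=\sigma^{-1}\sigma=1$, $q\sigma D_i=D_i\sigma$ and, if $q$ is a primitive $l$-th root of unity with $l\ge 2$, also $D_1^l=D_2^l=0$; its coalgebra structure is given by $\Delta(D_1)=D_1\otimes\sigma+1\otimes D_1$, $\Delta(D_2)=D_2\otimes1+\sigma\otimes D_2$, $\Delta(\sigma)=\sigma\otimes\sigma$, $\epsilon(D_i)=0$, $\epsilon(\sigma)=1$. Let $G$ be a group with a representation on a finite dimensional $k$-vector space $V$, let $f\colon G\times G\to k^{\times}$ be a normal $2$-cocycle, and let $A=S(V)\#_fG$ be the crossed product: the free left $S(V)$-module with basis $\{w_g: g\in G\}$ and product $(Pw_g)(Qw_h)=P\,{}^g\!Q\,f(g,h)\,w_{gh}$. Let $\hat\alpha\colon V\to V$ be a bijective $k[G]$-linear map and $\chi_\alpha\colon G\to k^{\times}$ a group homomorphism, let $\alpha$ be the automorphism of $A$ with $\alpha(v_1\cdots v_mw_g)=\hat\alpha(v_1)\cdots\hat\alpha(v_m)\chi_\alpha(g)w_g$,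 and let $s\colon H_q\otimes A\to A\otimes H_q$ be the associated good transposition, that is, $s(\sigma^iD_1^jD_2^m\otimes a)=\alpha^{j-m}(a)\otimes\sigma^iD_1^jD_2^m$. An $H_q$-module algebra structure on $(A,s)$ is a left $H_q$-module structure $\rho$ on $A$ such that $s$ is a left transposition (bijective, and compatible with the bialgebra structure of $H_q$, with the flip $\tau$ of $H_q\otimes H_q$ and with the algebra structure of $A$), $s(H_q\otimes\rho)=(\rho\otimes H_q)(H_q\otimes s)(\tau\otimes A)$, $\rho(H_q\otimes\mu_A)=\mu_A(\rho\otimes\rho)(H_q\otimes s\otimes A)(\Delta\otimes A\otimes A)$, and $h\cdot1=\epsilon(h)1$ for all $h\in H_q$. Let $\hat\varsigma\colon V\to V$ and $\hat\delta_1,\hat\delta_2\colon V\to A$ be $k$-linear maps and $\chi_\varsigma\colon G\to k^{\times}$ a map. Assume that $\ker\hat\delta_1\neq\ker\hat\delta_2$ have codimension $1$ in $V$, that $x_1\in\ker\hat\delta_2\setminus\ker\hat\delta_1$ and $x_2\in\ker\hat\delta_1\setminus\ker\hat\delta_2$, and that $$\hat\delta_i(x_i)=\sum_{j=1}^{n_i}P^{(i)}_{g_{ij}}w_{g_{ij}}\qquad(i=1,2)$$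 with $g_{i1},\dots,g_{in_i}$ different elements of $G$ and $P^{(i)}_{g_{ij}}\in S(V)\setminus\{0\}$. Let $\lambda_{ig},\omega_i,\nu_i\in k$ be the elements such that ${}^g\!x_i-\lambda_{ig}x_i$, $\hat\varsigma(x_i)-\omega_ix_i$ and $\hat\alpha(x_i)-\nu_ix_i$ belong to $\ker\hat\delta_i$. Let $\varsigma\colon A\to A$ be the linear map with $\varsigma(v_1\cdots v_mw_g)=\hat\varsigma(v_1)\cdots\hat\varsigma(v_m)\chi_\varsigma(g)w_g$. Then there is an $H_q$-module algebra structure on $(A,s)$ satisfying $$\sigma\cdot v=\hat\varsigma(v),\quad \sigma\cdot w_g=\chi_\varsigma(g)w_g,\quad D_i\cdot v=\hat\delta_i(v),\quad D_i\cdot w_g=0\qquad(v\in V,\ g\in G,\ i\in\{1,2\})$$ if and only if the following conditions hold: 1. $\hat\varsigma$ is bijective and $k[G]$-linear and $\chi_\varsigma$ is a group homomorphism; 2. $\hat\varsigma(v)={}^{g_{1j}^{-1}}\!\hat\alpha(v)$ for $j\le n_1$, $v\in\ker\hat\delta_1$, and $\hat\varsigma(v)={}^{g_{2j}}\!\hat\alpha(v)$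 for $j\le n_2$, $v\in\ker\hat\delta_2$; 3. $\{g_{ij}:1\le j\le n_i\}$ is a union of conjugacy classes of $G$ for $i=1,2$; 4. $\ker\hat\delta_1$ and $\ker\hat\delta_2$ are $G$-submodules of $V$; 5. ${}^g\!P^{(1)}_{g_{1j}}=\lambda_{1g}\chi_\alpha^{-1}(g)\chi_\varsigma(g)f^{-1}(g,g_{1j})f(gg_{1j}g^{-1},g)P^{(1)}_{gg_{1j}g^{-1}}$ for $g\in G$, $j\le n_1$; 6. ${}^g\!P^{(2)}_{g_{2j}}=\lambda_{2g}\chi_\alpha(g)\chi_\varsigma^{-1}(g)f^{-1}(g,g_{2j})f(gg_{2j}g^{-1},g)P^{(2)}_{gg_{2j}g^{-1}}$ for $g\in G$, $j\le n_2$; 7. $\hat\alpha(\ker\hat\delta_i)=\ker\hat\delta_i$ for $i=1,2$; 8. $\delta_2\bigl(\sum_jP^{(1)}_{g_{1j}}w_{g_{1j}}\bigr)=0$ and $\delta_1\bigl(\sum_jP^{(2)}_{g_{2j}}w_{g_{2j}}\bigr)=0$, where $\delta_1,\delta_2\colon A\to A$ are the linear maps with $$\delta_1(v_1\cdots v_mw_g)=\sum_{j=1}^m\alpha(v_1\cdots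 v_{j-1})\hat\delta_1(v_j)\varsigma(v_{j+1}\cdots v_mw_g),$$ $$\delta_2(v_1\cdots v_mw_g)=\sum_{j=1}^m\varsigma\bigl(\alpha^{-1}(v_1\cdots v_{j-1})\bigr)\hat\delta_2(v_j)v_{j+1}\cdots v_mw_g;$$ 9. $\varsigma(P^{(i)}_{g_{ij}})=q^{-1}\omega_i\chi_\varsigma^{-1}(g_{ij})P^{(i)}_{g_{ij}}$ and $\alpha(P^{(i)}_{g_{ij}})=\nu_i\chi_\alpha^{-1}(g_{ij})P^{(i)}_{g_{ij}}$ for $i=1,2$, $j\le n_i$; 10. if $q$ is a primitive $l$-th root of unity with $l\ge2$, then $\delta_1^l=\delta_2^l=0$. Moreover, whenever conditions 2 and 7 hold, the maps $\delta_1,\delta_2$ of condition 8 exist and are unique. -/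

import Mathlib

open scoped TensorProduct

noncomputable section

namespace BraidedHq

universe u v w

/-! ### Auxiliary facts on `q`-commuting elements -/

section QBinomial

variable {k : Type u} [Field k]

/-- Gaussian binomial coefficients evaluated at `q`. -/
def qChoose (q : k) : ℕ → ℕ → k
  | _, 0 => 1
  | 0, _ + 1 => 0
  | n + 1, j + 1 => qChoose q n j + q ^ (j + 1) * qChoose q n (j + 1)

lemma qChoose_zero_right (q : k) (n : ℕ) : qChoose q n 0 = 1 := by
  cases n <;> simp [qChoose]

lemma qChoose_of_lt (q : k) : ∀ n j : ℕ, n < j → qChoose q n j = 0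
  | 0, 0, h => by omega
  | n + 1, 0, h => by omega
  | 0, j + 1, _ => by simp [qChoose]
  | n + 1, j + 1, h => by
    simp [qChoose, qChoose_of_lt q n j (by omega), qChoose_of_lt q n (j + 1) (by omega)]

lemma qChoose_self (q : k) : ∀ n : ℕ, qChoose q n n = 1
  | 0 => by simp [qChoose]
  | n + 1 => by simp [qChoose, qChoose_self q n, qChoose_of_lt q n (n + 1) (by omega)]

lemma qChoose_symm_aux (q : k) : ∀ n j : ℕ, j ≤ n →
    qChoose q n (j + 1) * (∑ i ∈ Finset.range (j + 1), q ^ i) =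
      qChoose q n j * (∑ i ∈ Finset.range (n - j), q ^ i) := by
  have hadd : ∀ a b : ℕ, (∑ i ∈ Finset.range a, q ^ i) +
      q ^ a * (∑ i ∈ Finset.range b, q ^ i) = ∑ i ∈ Finset.range (a + b), q ^ i := by
    intro a b
    rw [Finset.sum_range_add, Finset.mul_sum]
    simp [pow_add]
  intro n
  induction n with
  | zero =>
    intro j hj
    obtain rfl : j = 0 := by omega
    simp [qChoose]
  | succ n ih =>
    have key : ∀ j, j ≤ n → qChoose q (n + 1) (j + 1) * (∑ i ∈ Finset.range (j + 1), q ^ i) =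
        qChoose q n j * (∑ i ∈ Finset.range (n + 1), q ^ i) := by
      intro j hj
      have h := ih j hj
      have h2 := hadd (j + 1) (n - j)
      rw [show j + 1 + (n - j) = n + 1 by omega] at h2
      rw [← h2, qChoose]
      linear_combination q ^ (j + 1) * h
    intro j hj
    rcases Nat.lt_or_ge n j with hlt | hle
    · obtain rfl : j = n + 1 := by omega
      simp [qChoose_of_lt q (n + 1) (n + 2) (by omega)]
    · rw [key j hle]
      cases j with
      | zero => simp [qChoose_zero_right]
      | succ j =>
        have h := ih j (by omega)
        have h2 := hadd (j + 1) (n - j)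
        rw [show j + 1 + (n - j) = n + 1 by omega] at h2
        rw [← h2, qChoose, show n + 1 - (j + 1) = n - j by omega]
        linear_combination h

/-- If `q` is a primitive `l`-th root of unity, the inner Gaussian binomials vanish. -/
lemma qChoose_eq_zero {q : k} {l : ℕ} (hq : IsPrimitiveRoot q l) (j : ℕ) (hj : 0 < j)
    (hjl : j < l) : qChoose q l j = 0 := by
  have hne : ∀ m, 0 < m → m < l → (∑ i ∈ Finset.range m, q ^ i) ≠ 0 := by
    intro m hm hml h0
    have h := geom_sum_mul q m
    rw [h0, zero_mul] at h
    exact hq.pow_ne_one_of_pos_of_lt hm.ne' hml (sub_eq_zero.mp h.symm)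
  have h0 : (∑ i ∈ Finset.range l, q ^ i) = 0 := hq.geom_sum_eq_zero (by omega)
  induction j with
  | zero => omega
  | succ j ih =>
    have h := qChoose_symm_aux q l j (by omega)
    have hz : qChoose q l j * (∑ i ∈ Finset.range (l - j), q ^ i) = 0 := by
      rcases Nat.eq_zero_or_pos j with rfl | hpos
      · simp [h0]
      · simp [ih hpos (by omega)]
    rw [hz] at h
    exact (mul_eq_zero.mp h).resolve_right (hne _ hj hjl)

lemma add_pow_qcomm {R : Type v} [Ring R] [Algebra k R] (q : k) (a b : R)
    (h : b * a = q • (a * b)) (n : ℕ) :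
    (a + b) ^ n = ∑ j ∈ Finset.range (n + 1), qChoose q n j • (a ^ j * b ^ (n - j)) := by
  have hb : ∀ j : ℕ, b * a ^ j = q ^ j • (a ^ j * b) := by
    intro j
    induction j with
    | zero => simp
    | succ j ih =>
      rw [pow_succ, ← mul_assoc, ih, smul_mul_assoc, mul_assoc, h, mul_smul_comm, smul_smul,
        ← pow_succ, mul_assoc]
  induction n with
  | zero => simp [qChoose]
  | succ n ih =>
    rw [pow_succ', ih, add_mul, Finset.mul_sum, Finset.mul_sum]
    have h1 : ∀ j, a * (qChoose q n j • (a ^ j * b ^ (n - j))) =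
        qChoose q n j • (a ^ (j + 1) * b ^ (n - j)) := by
      intro j
      rw [mul_smul_comm, ← mul_assoc, ← pow_succ']
    have h2 : ∀ j ∈ Finset.range (n + 1), b * (qChoose q n j • (a ^ j * b ^ (n - j))) =
        (q ^ j * qChoose q n j) • (a ^ j * b ^ (n + 1 - j)) := by
      intro j hj
      have : n + 1 - j = (n - j) + 1 := by have := Finset.mem_range.mp hj; omega
      rw [mul_smul_comm, ← mul_assoc, hb, smul_mul_assoc, smul_smul, mul_assoc, ← pow_succ',
        this, mul_comm]
    rw [Finset.sum_congr rfl (fun j _ => h1 j), Finset.sum_congr rfl h2]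
    rw [Finset.sum_range_succ' _ (n + 1)]
    have h3 : ∑ j ∈ Finset.range (n + 1), (q ^ j * qChoose q n j) • (a ^ j * b ^ (n + 1 - j)) =
        ∑ j ∈ Finset.range (n + 1 + 1),
          (q ^ j * qChoose q n j) • (a ^ j * b ^ (n + 1 - j)) := by
      rw [Finset.sum_range_succ _ (n + 1)]
      simp [qChoose_of_lt q n (n + 1) (by omega)]
    rw [h3, Finset.sum_range_succ' _ (n + 1), ← add_assoc, ← Finset.sum_add_distrib]
    congr 1
    · refine Finset.sum_congr rfl fun j _ => ?_
      rw [show n + 1 - (j + 1) = n - j by omega, ← add_smul]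
      rfl
    · simp [qChoose_zero_right]

/-- `(a + b)ˡ = aˡ + bˡ` if `b a = q a b` and `q` is a primitive `l`-th root of unity, `l ≥ 2`. -/
lemma add_pow_of_isPrimitiveRoot {R : Type v} [Ring R] [Algebra k R] {q : k} {l : ℕ}
    (hl : 2 ≤ l) (hq : IsPrimitiveRoot q l) (a b : R) (h : b * a = q • (a * b)) :
    (a + b) ^ l = a ^ l + b ^ l := by
  rw [add_pow_qcomm q a b h, Finset.sum_range_succ]
  obtain ⟨m, rfl⟩ : ∃ m, l = m + 1 := ⟨l - 1, by omega⟩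
  rw [Finset.sum_range_succ', Finset.sum_eq_zero]
  · simp [qChoose_self, qChoose_zero_right, add_comm]
  · intro j hj
    rw [qChoose_eq_zero hq (j + 1) (by omega) (by have := Finset.mem_range.mp hj; omega), zero_smul]

end QBinomial

/-! ### The bialgebra `H_q` -/

/-- The generators `D₁ = D 0`, `D₂ = D 1`, `σ`, `σ⁻¹`. -/
inductive Gen : Type
  | D (i : Fin 2)
  | sigma
  | sigmaInv

section Hq

variable (k : Type u) [Field k] (q : kˣ)

/-- The defining relations of `H_q`; the last one is present only if `q` is a primitive `l`-th root
of unity for some `l ≥ 2`. -/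
inductive HqRel : FreeAlgebra k Gen → FreeAlgebra k Gen → Prop
  | comm : HqRel (FreeAlgebra.ι k (.D 0) * FreeAlgebra.ι k (.D 1))
      (FreeAlgebra.ι k (.D 1) * FreeAlgebra.ι k (.D 0))
  | sigma_mul_inv : HqRel (FreeAlgebra.ι k .sigma * FreeAlgebra.ι k .sigmaInv) 1
  | inv_mul_sigma : HqRel (FreeAlgebra.ι k .sigmaInv * FreeAlgebra.ι k .sigma) 1
  | skew (i : Fin 2) : HqRel ((q : k) • (FreeAlgebra.ι k .sigma * FreeAlgebra.ι k (.D i)))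
      (FreeAlgebra.ι k (.D i) * FreeAlgebra.ι k .sigma)
  | nil (i : Fin 2) (l : ℕ) (hl : 2 ≤ l) (hq : IsPrimitiveRoot q l) :
      HqRel (FreeAlgebra.ι k (.D i) ^ l) 0

/-- The algebra `H_q`. -/
def Hq : Type u := RingQuot (HqRel k q)

namespace Hq

instance : Ring (Hq k q) := inferInstanceAs (Ring (RingQuot (HqRel k q)))

instance : Algebra k (Hq k q) := inferInstanceAs (Algebra k (RingQuot (HqRel k q)))

/-- The class of a generator in `H_q`. -/
def gen (x : Gen) : Hq k q := RingQuot.mkAlgHom k (HqRel k q) (FreeAlgebra.ι k x)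

/-- `D k q 0` is `D₁` and `D k q 1` is `D₂`. -/
abbrev D (i : Fin 2) : Hq k q := gen k q (.D i)

/-- The generator `σ`. -/
abbrev sigma : Hq k q := gen k q .sigma

/-- The generator `σ⁻¹`. -/
abbrev sigmaInv : Hq k q := gen k q .sigmaInv

lemma D_comm : D k q 0 * D k q 1 = D k q 1 * D k q 0 := by
  have := RingQuot.mkAlgHom_rel k (HqRel.comm (k := k) (q := q))
  rw [map_mul, map_mul] at this
  exact this

lemma sigma_mul_sigmaInv : sigma k q * sigmaInv k q = 1 := by
  have := RingQuot.mkAlgHom_rel k (HqRel.sigma_mul_inv (k := k) (q := q))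
  rw [map_mul, map_one] at this
  exact this

lemma sigmaInv_mul_sigma : sigmaInv k q * sigma k q = 1 := by
  have := RingQuot.mkAlgHom_rel k (HqRel.inv_mul_sigma (k := k) (q := q))
  rw [map_mul, map_one] at this
  exact this

lemma D_mul_sigma (i : Fin 2) : D k q i * sigma k q = (q : k) • (sigma k q * D k q i) := by
  have := RingQuot.mkAlgHom_rel k (HqRel.skew (k := k) (q := q) i)
  rw [map_smul, map_mul, map_mul] at this
  exact this.symm

lemma D_pow (i : Fin 2) {l : ℕ} (hl : 2 ≤ l) (hq : IsPrimitiveRoot q l) : D k q i ^ l = 0 := by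
  have := RingQuot.mkAlgHom_rel k (HqRel.nil (k := k) (q := q) i l hl hq)
  rw [map_pow, map_zero] at this
  exact this

variable {k q}

/-- The universal property of `H_q`. -/
def lift {B : Type v} [Ring B] [Algebra k B] (d : Fin 2 → B) (s t : B)
    (hd : d 0 * d 1 = d 1 * d 0) (hst : s * t = 1) (hts : t * s = 1)
    (hsd : ∀ i, d i * s = (q : k) • (s * d i))
    (hnil : ∀ i l, 2 ≤ l → IsPrimitiveRoot q l → d i ^ l = 0) : Hq k q →ₐ[k] B :=
  RingQuot.liftAlgHom k ⟨FreeAlgebra.lift k (fun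
    | .D i => d i
    | .sigma => s
    | .sigmaInv => t), by
      intro x y h
      cases h with
      | comm => simpa using hd
      | sigma_mul_inv => simpa using hst
      | inv_mul_sigma => simpa using hts
      | skew i => simpa using (hsd i).symm
      | nil i l hl hq => simpa using hnil i l hl hq⟩

section lift

variable {B : Type v} [Ring B] [Algebra k B] (d : Fin 2 → B) (s t : B)
    (hd : d 0 * d 1 = d 1 * d 0) (hst : s * t = 1) (hts : t * s = 1)
    (hsd : ∀ i, d i * s = (q : k) • (s * d i))
    (hnil : ∀ i l, 2 ≤ l → IsPrimitiveRoot q l → d i ^ l = 0)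

@[simp] lemma lift_D (i : Fin 2) : lift (q := q) d s t hd hst hts hsd hnil (D k q i) = d i := by
  unfold lift D gen
  exact (RingQuot.liftAlgHom_mkAlgHom_apply ..).trans (by simp)

@[simp] lemma lift_sigma : lift (q := q) d s t hd hst hts hsd hnil (sigma k q) = s := by
  unfold lift sigma gen
  exact (RingQuot.liftAlgHom_mkAlgHom_apply ..).trans (by simp)

@[simp] lemma lift_sigmaInv : lift (q := q) d s t hd hst hts hsd hnil (sigmaInv k q) = t := by
  unfold lift sigmaInv gen
  exact (RingQuot.liftAlgHom_mkAlgHom_apply ..).trans (by simp)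

end lift

lemma algHom_ext {B : Type v} [Semiring B] [Algebra k B] {f g : Hq k q →ₐ[k] B}
    (hD : ∀ i, f (D k q i) = g (D k q i)) (hs : f (sigma k q) = g (sigma k q))
    (ht : f (sigmaInv k q) = g (sigmaInv k q)) : f = g := by
  refine RingQuot.ringQuot_ext' k f g (FreeAlgebra.hom_ext (funext fun x => ?_))
  cases x with
  | D i => exact hD i
  | sigma => exact hs
  | sigmaInv => exact ht

variable (k q)

/-- The comultiplication of `H_q`: `Δ(D₁) = D₁ ⊗ σ + 1 ⊗ D₁`, `Δ(D₂) = D₂ ⊗ 1 + σ ⊗ D₂`,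
`Δ(σ^{±1}) = σ^{±1} ⊗ σ^{±1}`. -/
def comulHom : Hq k q →ₐ[k] Hq k q ⊗[k] Hq k q :=
  lift ![D k q 0 ⊗ₜ sigma k q + 1 ⊗ₜ D k q 0, D k q 1 ⊗ₜ 1 + sigma k q ⊗ₜ D k q 1]
    (sigma k q ⊗ₜ sigma k q) (sigmaInv k q ⊗ₜ sigmaInv k q)
    (by
      simp only [Matrix.cons_val_zero, Matrix.cons_val_one, mul_add, add_mul,
        Algebra.TensorProduct.tmul_mul_tmul, one_mul, mul_one, D_comm, D_mul_sigma,
        TensorProduct.smul_tmul', TensorProduct.tmul_smul]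
      abel)
    (by simp [sigma_mul_sigmaInv, Algebra.TensorProduct.one_def])
    (by simp [sigmaInv_mul_sigma, Algebra.TensorProduct.one_def])
    (by
      intro i
      fin_cases i <;>
      simp [mul_add, add_mul, D_mul_sigma, TensorProduct.smul_tmul', TensorProduct.tmul_smul])
    (by
      intro i l hl hq
      have hq' : IsPrimitiveRoot (q : k) l := IsPrimitiveRoot.coe_units_iff.mpr hq
      fin_cases i
      · simp only [Fin.zero_eta, Matrix.cons_val_zero]
        rw [add_pow_of_isPrimitiveRoot hl hq' _ _ (by
          simp [D_mul_sigma, TensorProduct.tmul_smul])]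
        simp [D_pow k q 0 hl hq]
      · change (D k q 1 ⊗ₜ[k] (1 : Hq k q) + sigma k q ⊗ₜ[k] D k q 1) ^ l = 0
        rw [add_comm, add_pow_of_isPrimitiveRoot hl hq' _ _ (by
          simp [D_mul_sigma, TensorProduct.smul_tmul'])]
        simp [D_pow k q 1 hl hq])

/-- The counit of `H_q`: `ε(Dᵢ) = 0`, `ε(σ^{±1}) = 1`. -/
def counitHom : Hq k q →ₐ[k] k :=
  lift (fun _ => 0) 1 1 (by simp) (by simp) (by simp) (by simp)
    (fun _ l hl _ => zero_pow (by omega))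

@[simp] lemma comulHom_D_zero :
    comulHom k q (D k q 0) = D k q 0 ⊗ₜ sigma k q + 1 ⊗ₜ D k q 0 := by
  simp [comulHom]

@[simp] lemma comulHom_D_one :
    comulHom k q (D k q 1) = D k q 1 ⊗ₜ 1 + sigma k q ⊗ₜ D k q 1 := by
  simp [comulHom]

@[simp] lemma comulHom_sigma : comulHom k q (sigma k q) = sigma k q ⊗ₜ sigma k q := by
  simp [comulHom]

@[simp] lemma comulHom_sigmaInv :
    comulHom k q (sigmaInv k q) = sigmaInv k q ⊗ₜ sigmaInv k q := by
  simp [comulHom]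

@[simp] lemma counitHom_D (i : Fin 2) : counitHom k q (D k q i) = 0 := by
  simp [counitHom]

@[simp] lemma counitHom_sigma : counitHom k q (sigma k q) = 1 := by
  simp [counitHom]

@[simp] lemma counitHom_sigmaInv : counitHom k q (sigmaInv k q) = 1 := by
  simp [counitHom]

/-- The bialgebra structure of `H_q`. -/
instance : Bialgebra k (Hq k q) :=
  Bialgebra.ofAlgHom (comulHom k q) (counitHom k q)
    (by
      refine algHom_ext (fun i => ?_) ?_ ?_
      · fin_cases i <;>
        simp [TensorProduct.add_tmul, TensorProduct.tmul_add, Algebra.TensorProduct.one_def,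
          add_assoc]
      · simp
      · simp)
    (by
      refine algHom_ext (fun i => ?_) ?_ ?_
      · fin_cases i <;> simp
      · simp
      · simp)
    (by
      refine algHom_ext (fun i => ?_) ?_ ?_
      · fin_cases i <;> simp
      · simp
      · simp)

end Hq

end Hq

/-! ### Transpositions and module algebras

`H` is a bialgebra, regarded as a braided bialgebra whose braid is the flip. -/

section Transposition

variable {k : Type u} [Field k] {H : Type v} [Ring H] [Bialgebra k H]
  {A : Type w} [Ring A] [Algebra k A]

/-- `(s ⊗ H) ∘ (H ⊗ s) : H ⊗ H ⊗ A → A ⊗ H ⊗ H`. -/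
def slideHH (s : H ⊗[k] A →ₗ[k] A ⊗[k] H) : H ⊗[k] (H ⊗[k] A) →ₗ[k] A ⊗[k] (H ⊗[k] H) :=
  (TensorProduct.assoc k A H H).toLinearMap ∘ₗ s.rTensor H ∘ₗ
    (TensorProduct.assoc k H A H).symm.toLinearMap ∘ₗ s.lTensor H

/-- `(A ⊗ s) ∘ (s ⊗ A) : H ⊗ A ⊗ A → A ⊗ A ⊗ H`. -/
def slideAA (s : H ⊗[k] A →ₗ[k] A ⊗[k] H) : H ⊗[k] (A ⊗[k] A) →ₗ[k] (A ⊗[k] A) ⊗[k] H :=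
  (TensorProduct.assoc k A A H).symm.toLinearMap ∘ₗ s.lTensor A ∘ₗ
    (TensorProduct.assoc k A H A).toLinearMap ∘ₗ s.rTensor A ∘ₗ
    (TensorProduct.assoc k H A A).symm.toLinearMap

/-- `H ⊗ s ⊗ A : H ⊗ H ⊗ A ⊗ A → H ⊗ A ⊗ H ⊗ A`. -/
def slideMid (s : H ⊗[k] A →ₗ[k] A ⊗[k] H) :
    (H ⊗[k] H) ⊗[k] (A ⊗[k] A) →ₗ[k] (H ⊗[k] A) ⊗[k] (H ⊗[k] A) :=
  (TensorProduct.assoc k H A (H ⊗[k] A)).symm.toLinearMap ∘ₗ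
    ((TensorProduct.assoc k A H A).toLinearMap ∘ₗ s.rTensor A ∘ₗ
      (TensorProduct.assoc k H A A).symm.toLinearMap).lTensor H ∘ₗ
    (TensorProduct.assoc k H H (A ⊗[k] A)).toLinearMap

/-- The flip of the first two factors, `H ⊗ H ⊗ A → H ⊗ H ⊗ A`. -/
def flipHH : H ⊗[k] (H ⊗[k] A) →ₗ[k] H ⊗[k] (H ⊗[k] A) :=
  (TensorProduct.leftComm k H H A).toLinearMap

/-- `s` is a left transposition of `H` on the algebra `A`: a bijective linear map
`H ⊗ A → A ⊗ H`, compatible with the unit, the multiplication, the counit, the comultiplication and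
the braid (the flip) of `H`, and with the unit and the multiplication of `A`. -/
structure IsLeftTransposition (s : H ⊗[k] A →ₗ[k] A ⊗[k] H) : Prop where
  bijective : Function.Bijective s
  unit_left : ∀ a : A, s (1 ⊗ₜ a) = a ⊗ₜ 1
  mul_left : s ∘ₗ (LinearMap.mul' k H).rTensor A ∘ₗ (TensorProduct.assoc k H H A).symm.toLinearMap =
    (LinearMap.mul' k H).lTensor A ∘ₗ slideHH s
  counit_left : (TensorProduct.rid k A).toLinearMap ∘ₗ (Coalgebra.counit (R := k)).lTensor A ∘ₗ s =
    (TensorProduct.lid k A).toLinearMap ∘ₗ (Coalgebra.counit (R := k) (A := H)).rTensor A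
  comul_left : (Coalgebra.comul (R := k) (A := H)).lTensor A ∘ₗ s =
    slideHH s ∘ₗ (TensorProduct.assoc k H H A).toLinearMap ∘ₗ
      (Coalgebra.comul (R := k) (A := H)).rTensor A
  braid : slideHH s ∘ₗ flipHH =
    (TensorProduct.comm k H H).toLinearMap.lTensor A ∘ₗ slideHH s
  unit_right : ∀ h : H, s (h ⊗ₜ 1) = 1 ⊗ₜ h
  mul_right : s ∘ₗ (LinearMap.mul' k A).lTensor H =
    (LinearMap.mul' k A).rTensor H ∘ₗ slideAA s

/-- The action map `H ⊗ A → A` of a left `H`-module structure on `A`. -/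
def actionMap (act : H →ₐ[k] Module.End k A) : H ⊗[k] A →ₗ[k] A :=
  TensorProduct.lift act.toLinearMap

/-- The left `H`-module structure `act` makes `(A, s)` a left `H`-(braided) module algebra. -/
structure IsModuleAlgebra (s : H ⊗[k] A →ₗ[k] A ⊗[k] H) (act : H →ₐ[k] Module.End k A) :
    Prop where
  transposition : IsLeftTransposition s
  /-- `s ∘ (H ⊗ ρ) = (ρ ⊗ H) ∘ (H ⊗ s) ∘ (c ⊗ A)`, with `c` the flip -/
  compat : s ∘ₗ (actionMap act).lTensor H =
    (actionMap act).rTensor H ∘ₗ (TensorProduct.assoc k H A H).symm.toLinearMap ∘ₗ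
      s.lTensor H ∘ₗ flipHH
  /-- `ρ ∘ (H ⊗ μ) = μ ∘ (ρ ⊗ ρ) ∘ (H ⊗ s ⊗ A) ∘ (Δ ⊗ A ⊗ A)` -/
  act_mul : actionMap act ∘ₗ (LinearMap.mul' k A).lTensor H =
    LinearMap.mul' k A ∘ₗ TensorProduct.map (actionMap act) (actionMap act) ∘ₗ slideMid s ∘ₗ
      (Coalgebra.comul (R := k) (A := H)).rTensor (A ⊗[k] A)
  act_one : ∀ h : H, act h 1 = Coalgebra.counit (R := k) h • (1 : A)

end Transposition

section GoodTransposition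

variable {k : Type u} [Field k] (q : kˣ) {A : Type w} [Ring A] [Algebra k A]

/-- The algebra map `H_q → End(A) ⊗ H_q` with `σ^{±1} ↦ id ⊗ σ^{±1}`, `D₁ ↦ α ⊗ D₁`,
`D₂ ↦ α⁻¹ ⊗ D₂`. -/
def goodHom (α : A ≃ₗ[k] A) : Hq k q →ₐ[k] Module.End k A ⊗[k] Hq k q :=
  Hq.lift (q := q) ![(α.toLinearMap : Module.End k A) ⊗ₜ[k] Hq.D k q 0,
      (α.symm.toLinearMap : Module.End k A) ⊗ₜ[k] Hq.D k q 1]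
    (1 ⊗ₜ Hq.sigma k q) (1 ⊗ₜ Hq.sigmaInv k q)
    (by
      have h1 : (α.toLinearMap : Module.End k A) * α.symm.toLinearMap = 1 := by ext; simp
      have h2 : (α.symm.toLinearMap : Module.End k A) * α.toLinearMap = 1 := by ext; simp
      simp [h1, h2, Hq.D_comm])
    (by simp [Hq.sigma_mul_sigmaInv, Algebra.TensorProduct.one_def])
    (by simp [Hq.sigmaInv_mul_sigma, Algebra.TensorProduct.one_def])
    (by intro i; fin_cases i <;> simp [Hq.D_mul_sigma, TensorProduct.tmul_smul])
    (by
      intro i l hl hq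
      fin_cases i <;> simp [Hq.D_pow k q _ hl hq])

/-- The good transposition of `H_q` on `A` associated with the automorphism `α`: the linear map with
`s(σⁱ D₁ʲ D₂ᵐ ⊗ a) = α^{j-m}(a) ⊗ σⁱ D₁ʲ D₂ᵐ`. -/
def goodTransposition (α : A ≃ₗ[k] A) : Hq k q ⊗[k] A →ₗ[k] A ⊗[k] Hq k q :=
  TensorProduct.lift
    (LinearMap.lcomp k (A ⊗[k] Hq k q) (goodHom q α).toLinearMap ∘ₗ
      LinearMap.rTensorHom (Hq k q) ∘ₗ LinearMap.applyₗ).flip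

lemma goodTransposition_sigma (α : A ≃ₗ[k] A) (a : A) :
    goodTransposition q α (Hq.sigma k q ⊗ₜ a) = a ⊗ₜ Hq.sigma k q := by
  simp [goodTransposition, goodHom]

lemma goodTransposition_D_zero (α : A ≃ₗ[k] A) (a : A) :
    goodTransposition q α (Hq.D k q 0 ⊗ₜ a) = α a ⊗ₜ Hq.D k q 0 := by
  simp [goodTransposition, goodHom]

lemma goodTransposition_D_one (α : A ≃ₗ[k] A) (a : A) :
    goodTransposition q α (Hq.D k q 1 ⊗ₜ a) = α.symm a ⊗ₜ Hq.D k q 1 := by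
  simp [goodTransposition, goodHom]

end GoodTransposition

/-! ### Crossed products `S(V) #_f G` -/

/-- A normal `2`-cocycle `f : G × G → kˣ` (for the trivial action). -/
structure NormalCocycle (k : Type u) [Field k] (G : Type v) [Group G] where
  toFun : G → G → kˣ
  one_left : ∀ g, toFun 1 g = 1
  one_right : ∀ g, toFun g 1 = 1
  cocycle : ∀ g h l, toFun g h * toFun (g * h) l = toFun h l * toFun g (h * l)

instance (k : Type u) [Field k] (G : Type v) [Group G] :
    CoeFun (NormalCocycle k G) (fun _ => G → G → kˣ) := ⟨NormalCocycle.toFun⟩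

section Sym

variable {k : Type u} [Field k] {V : Type w} [AddCommGroup V] [Module k V]

/-- The algebra endomorphism of `S(V)` induced by a linear endomorphism of `V`. -/
def symMap (φ : V →ₗ[k] V) : SymmetricAlgebra k V →ₐ[k] SymmetricAlgebra k V :=
  SymmetricAlgebra.lift (SymmetricAlgebra.ι k V ∘ₗ φ)

@[simp] lemma symMap_ι (φ : V →ₗ[k] V) (v : V) :
    symMap φ (SymmetricAlgebra.ι k V v) = SymmetricAlgebra.ι k V (φ v) :=
  SymmetricAlgebra.lift_ι_apply ..

lemma symMap_id : symMap (LinearMap.id : V →ₗ[k] V) = AlgHom.id k _ :=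
  SymmetricAlgebra.algHom_ext (by ext v; simp)

lemma symMap_comp (φ ψ : V →ₗ[k] V) : symMap (φ ∘ₗ ψ) = (symMap φ).comp (symMap ψ) :=
  SymmetricAlgebra.algHom_ext (by ext v; simp)

lemma symMap_comp_apply (φ ψ : V →ₗ[k] V) (P : SymmetricAlgebra k V) :
    symMap φ (symMap ψ P) = symMap (φ ∘ₗ ψ) P := by
  rw [symMap_comp]; rfl

end Sym

section Crossed

variable {k : Type u} [Field k] {G : Type v} [Group G] {V : Type w} [AddCommGroup V] [Module k V]

/-- The crossed product `A = S(V) #_f G`: the free left `S(V)`-module with basis `{w_g : g ∈ G}`. -/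
def CrossedProduct (_ρ : Representation k G V) (_f : NormalCocycle k G) : Type (max u v w) :=
  G →₀ SymmetricAlgebra k V

namespace CrossedProduct

variable (ρ : Representation k G V) (f : NormalCocycle k G)

instance : AddCommGroup (CrossedProduct ρ f) :=
  inferInstanceAs (AddCommGroup (G →₀ SymmetricAlgebra k V))

instance : Module k (CrossedProduct ρ f) :=
  inferInstanceAs (Module k (G →₀ SymmetricAlgebra k V))

/-- `of ρ f g P` is the element `P w_g`. -/
def of (g : G) : SymmetricAlgebra k V →ₗ[k] CrossedProduct ρ f :=
  Finsupp.lsingle (R := k) g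

/-- A linear map on `S(V) #_f G` given by its values on the `P w_g`. -/
def liftLin {M : Type*} [AddCommMonoid M] [Module k M]
    (φ : G → SymmetricAlgebra k V →ₗ[k] M) : CrossedProduct ρ f →ₗ[k] M :=
  Finsupp.lsum k φ

variable {ρ f}

@[simp] lemma liftLin_of {M : Type*} [AddCommMonoid M] [Module k M]
    (φ : G → SymmetricAlgebra k V →ₗ[k] M) (g : G) (P : SymmetricAlgebra k V) :
    liftLin ρ f φ (of ρ f g P) = φ g P := by
  change Finsupp.lsum k φ (Finsupp.single g P) = φ g P
  simp

lemma hom_ext {M : Type*} [AddCommMonoid M] [Module k M] {φ ψ : CrossedProduct ρ f →ₗ[k] M}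
    (h : ∀ g P, φ (of ρ f g P) = ψ (of ρ f g P)) : φ = ψ :=
  Finsupp.lhom_ext h

lemma induction {motive : CrossedProduct ρ f → Prop} (a : CrossedProduct ρ f)
    (zero : motive 0) (add : ∀ a b, motive a → motive b → motive (a + b))
    (of : ∀ g P, motive (of ρ f g P)) : motive a :=
  Finsupp.induction_linear a zero add of

variable (ρ f)

/-- The product, `(P w_g) (Q w_h) = f(g, h) P ᵍQ w_{gh}`. -/
def mulLin : CrossedProduct ρ f →ₗ[k] CrossedProduct ρ f →ₗ[k] CrossedProduct ρ f :=
  liftLin ρ f fun g =>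
    { toFun := fun P => liftLin ρ f fun h =>
        (f g h : k) • (of ρ f (g * h) ∘ₗ LinearMap.mulLeft k P ∘ₗ (symMap (ρ g)).toLinearMap)
      map_add' := fun P Q => by
        refine hom_ext fun h R => ?_
        simp [add_mul]
      map_smul' := fun c P => by
        refine hom_ext fun h R => ?_
        simp [smul_comm c] }

lemma mulLin_of (g h : G) (P Q : SymmetricAlgebra k V) :
    mulLin ρ f (of ρ f g P) (of ρ f h Q) =
      of ρ f (g * h) ((f g h : k) • (P * symMap (ρ g) Q)) := by
  simp [mulLin]

instance : Mul (CrossedProduct ρ f) := ⟨fun a b => mulLin ρ f a b⟩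

instance : One (CrossedProduct ρ f) := ⟨of ρ f 1 1⟩

lemma mul_def (a b : CrossedProduct ρ f) : a * b = mulLin ρ f a b := rfl

lemma one_def : (1 : CrossedProduct ρ f) = of ρ f 1 1 := rfl

lemma of_mul_of (g h : G) (P Q : SymmetricAlgebra k V) :
    of ρ f g P * of ρ f h Q = of ρ f (g * h) ((f g h : k) • (P * symMap (ρ g) Q)) :=
  mulLin_of ρ f g h P Q

instance : Ring (CrossedProduct ρ f) where
  __ := (inferInstance : AddCommGroup (CrossedProduct ρ f))
  mul := (· * ·)
  one := 1
  left_distrib a b c := map_add (mulLin ρ f a) b c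
  right_distrib a b c := by simp only [mul_def, map_add, LinearMap.add_apply]
  zero_mul a := by simp only [mul_def, map_zero, LinearMap.zero_apply]
  mul_zero a := map_zero (mulLin ρ f a)
  one_mul a := by
    have : mulLin ρ f 1 = LinearMap.id := hom_ext fun g P => by
      rw [one_def, mulLin_of, map_one ρ]
      simp [f.one_left, show symMap (1 : V →ₗ[k] V) = AlgHom.id k _ from symMap_id]
    exact LinearMap.congr_fun this a
  mul_one a := by
    have : (mulLin ρ f).flip 1 = LinearMap.id := hom_ext fun g P => by
      rw [LinearMap.flip_apply, one_def, mulLin_of]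
      simp [f.one_right]
    exact LinearMap.congr_fun this a
  mul_assoc a b c := by
    have hl : ∀ x y z : CrossedProduct ρ f, (x + y) * z = x * z + y * z := fun x y z => by
      simp only [mul_def, map_add, LinearMap.add_apply]
    have hr : ∀ x y z : CrossedProduct ρ f, x * (y + z) = x * y + x * z := fun x y z =>
      map_add (mulLin ρ f x) y z
    have hzl : ∀ x : CrossedProduct ρ f, 0 * x = 0 := fun x => by
      simp only [mul_def, map_zero, LinearMap.zero_apply]
    have hzr : ∀ x : CrossedProduct ρ f, x * 0 = 0 := fun x => map_zero (mulLin ρ f x)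
    induction a using induction with
    | zero => simp only [hzl]
    | add a₁ a₂ h₁ h₂ => simp only [hl, h₁, h₂]
    | of g P =>
      induction b using induction with
      | zero => simp only [hzl, hzr]
      | add b₁ b₂ h₁ h₂ => simp only [hl, hr, h₁, h₂]
      | of h Q =>
        induction c using induction with
        | zero => simp only [hzr]
        | add c₁ c₂ h₁ h₂ => simp only [hr, h₁, h₂]
        | of l R =>
          have hc : (f g h : k) * f (g * h) l = f h l * f g (h * l) := by
            exact_mod_cast congrArg Units.val (f.cocycle g h l)
          have hs : symMap (ρ g) (symMap (ρ h) R) = symMap (ρ (g * h)) R := by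
            rw [symMap_comp_apply, map_mul]; rfl
          rw [of_mul_of, of_mul_of, of_mul_of, of_mul_of, map_smul (symMap (ρ g)),
            map_mul (symMap (ρ g)), hs, smul_mul_assoc, mul_smul_comm, smul_smul, smul_smul,
            mul_comm (f (g * h) l : k), hc, mul_comm (f h l : k), mul_assoc g, mul_assoc P]

instance : Algebra k (CrossedProduct ρ f) :=
  Algebra.ofModule
    (fun c a b => by simp only [mul_def, map_smul, LinearMap.smul_apply])
    (fun c a b => map_smul (mulLin ρ f a) c b)

variable {ρ f}

/-- The linear map `P w_g ↦ S(φ)(P) χ(g) w_g`, that is,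
`v₁ ⋯ v_m w_g ↦ φ(v₁) ⋯ φ(v_m) χ(g) w_g`. -/
def diag (φ : V →ₗ[k] V) (χ : G → kˣ) : CrossedProduct ρ f →ₗ[k] CrossedProduct ρ f :=
  liftLin ρ f fun g => (χ g : k) • (of ρ f g ∘ₗ (symMap φ).toLinearMap)

@[simp] lemma diag_of (φ : V →ₗ[k] V) (χ : G → kˣ) (g : G) (P : SymmetricAlgebra k V) :
    diag φ χ (of ρ f g P) = (χ g : k) • of ρ f g (symMap φ P) := by
  simp [diag]

/-- The bijection `α : v₁ ⋯ v_m w_g ↦ φ(v₁) ⋯ φ(v_m) χ(g) w_g` for `φ` bijective. -/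
def diagEquiv (φ : V ≃ₗ[k] V) (χ : G → kˣ) : CrossedProduct ρ f ≃ₗ[k] CrossedProduct ρ f :=
  LinearEquiv.ofLinearMap (diag φ.toLinearMap χ) (diag φ.symm.toLinearMap χ⁻¹)
    (hom_ext fun g P => by
      simp [symMap_comp_apply, show symMap (LinearMap.id : V →ₗ[k] V) = _ from symMap_id, smul_smul])
    (hom_ext fun g P => by
      simp [symMap_comp_apply, show symMap (LinearMap.id : V →ₗ[k] V) = _ from symMap_id, smul_smul])

end CrossedProduct

/-! ### The maps and conditions of the theorem -/

open CrossedProduct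

variable {ρ : Representation k G V} {f : NormalCocycle k G}

/-- `δ₁(v₁ ⋯ v_m w_g) = ∑ⱼ α(v₁ ⋯ v_{j-1}) δ̂₁(vⱼ) ς(v_{j+1} ⋯ v_m w_g)` for all
`v₁, …, v_m ∈ V`, `g ∈ G`. -/
def IsDelta₁ (α ς : CrossedProduct ρ f → CrossedProduct ρ f) (δhat : V →ₗ[k] CrossedProduct ρ f)
    (δ : CrossedProduct ρ f →ₗ[k] CrossedProduct ρ f) : Prop :=
  ∀ (m : ℕ) (x : Fin m → V) (g : G),
    δ (of ρ f g (∏ j, SymmetricAlgebra.ι k V (x j))) =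
      ∑ j, α (of ρ f 1 (∏ i ∈ Finset.Iio j, SymmetricAlgebra.ι k V (x i))) * δhat (x j) *
        ς (of ρ f g (∏ i ∈ Finset.Ioi j, SymmetricAlgebra.ι k V (x i)))

/-- `δ₂(v₁ ⋯ v_m w_g) = ∑ⱼ ς(α⁻¹(v₁ ⋯ v_{j-1})) δ̂₂(vⱼ) v_{j+1} ⋯ v_m w_g` for all
`v₁, …, v_m ∈ V`, `g ∈ G`. -/
def IsDelta₂ (αinv ς : CrossedProduct ρ f → CrossedProduct ρ f) (δhat : V →ₗ[k] CrossedProduct ρ f)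
    (δ : CrossedProduct ρ f →ₗ[k] CrossedProduct ρ f) : Prop :=
  ∀ (m : ℕ) (x : Fin m → V) (g : G),
    δ (of ρ f g (∏ j, SymmetricAlgebra.ι k V (x j))) =
      ∑ j, ς (αinv (of ρ f 1 (∏ i ∈ Finset.Iio j, SymmetricAlgebra.ι k V (x i)))) * δhat (x j) *
        of ρ f g (∏ i ∈ Finset.Ioi j, SymmetricAlgebra.ι k V (x i))

end Crossed

end BraidedHq

end

open BraidedHq BraidedHq.CrossedProduct

/-! For the good transposition, the module algebra axioms evaluated at the generators say that `σ`
acts by an algebra map `ς`, `D₁` by an `(α, ς)`-skew derivation and `D₂` by a `(ς α⁻¹, id)`-skew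
derivation. Since `D₁` acts nontrivially here, they also force every operator to commute with `α`.
Conversely, operators with these properties that satisfy the relations of `H_q` give a module
algebra (`isModuleAlgebra_of_isSkewDer`). No basis of `H_q` is needed: it is spanned by words in the
generators, and past a word of degree `n` the transposition moves `a` to `αⁿ(a)`.

It remains to decide when maps on `V` extend to such operators. A twisted derivation of `S(V)` along
algebra maps `a`, `b` is an algebra map into upper triangular `2 × 2` matrices, so it exists as soon
as its values on `V` respect `v w = w v`. As the kernel of `δ̂` has codimension one with complement
spanned by `x`, this amounts to `a(u) δ̂(x) = δ̂(x) b(u)` for `u` in the kernel. Comparing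
coefficients of `w_g` in the domain `S(V)` turns it into `a(u) = ᵍb(u)`, which is the condition on
`ς̂` over the kernels. Extending to all of `A`, with value zero on the `w_g`, requires compatibility
with `w_g v = ᵍv w_g`; coefficientwise this gives the conditions on conjugacy classes, on submodules
and on the equivariance of the polynomials (`group_relation_iff`).

Skew derivations are determined on generators, so commutation with `α` and `Dᵢ σ = q σ Dᵢ` need only
hold on `V` (`IsSkewDer.comp_diag`), where `diag_relation_iff` converts them into stability of the
kernels and the eigenvector conditions. Then `D₁ D₂ - D₂ D₁` is a `(ς, ς)`-skew derivation
(`IsSkewDer.commutator`), so it too is tested on `V`; as each `xᵢ` is killed by the other map, only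
`δ₂(δ̂₁(x₁)) = 0` and `δ₁(δ̂₂(x₂)) = 0` remain. Nilpotency at roots of unity is kept as a condition.
-/

noncomputable section

namespace BraidedHq

universe u v w

/-! ### Monomials of `H_q` and the good transposition -/

namespace Hq

section Monomial

variable (k : Type u) [Field k] (q : kˣ)

/-- Words in the generators of `H_q`, graded by `deg D₁ = 1`, `deg D₂ = -1`, `deg σ^{±1} = 0`. -/
inductive IsMonomial : ℤ → Hq k q → Prop
  | one : IsMonomial 0 1
  | sigma_mul {n : ℤ} {h : Hq k q} : IsMonomial n h → IsMonomial n (sigma k q * h)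
  | sigmaInv_mul {n : ℤ} {h : Hq k q} : IsMonomial n h → IsMonomial n (sigmaInv k q * h)
  | D_zero_mul {n : ℤ} {h : Hq k q} : IsMonomial n h → IsMonomial (1 + n) (D k q 0 * h)
  | D_one_mul {n : ℤ} {h : Hq k q} : IsMonomial n h → IsMonomial (-1 + n) (D k q 1 * h)

/-- The projection from the free algebra onto `H_q`. -/
def mk : FreeAlgebra k Gen →ₐ[k] Hq k q := RingQuot.mkAlgHom k (HqRel k q)

/-- Induction over `H_q` by left multiplication with generators. -/
lemma induction_gen_mul {p : Hq k q → Prop} (one : p 1) (add : ∀ x y, p x → p y → p (x + y))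
    (smul : ∀ (c : k) x, p x → p (c • x)) (gen_mul : ∀ g x, p x → p (gen k q g * x))
    (x : Hq k q) : p x := by
  obtain ⟨y, rfl⟩ : ∃ y, mk k q y = x := RingQuot.mkAlgHom_surjective k (HqRel k q) x
  -- Preservation of `p` under left multiplication by `y` is closed under products in `y`, whereas
  -- `p` itself need not be.
  suffices H : ∀ h : Hq k q, p h → p (mk k q y * h) by
    have := H 1 one
    rwa [mul_one] at this
  induction y using FreeAlgebra.induction with
  | grade0 r =>
    intro h hh
    rw [AlgHom.commutes, ← Algebra.smul_def]
    exact smul r h hh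
  | grade1 g => exact fun h hh => gen_mul g h hh
  | mul a b ha hb =>
    intro h hh
    rw [map_mul, mul_assoc]
    exact ha _ (hb _ hh)
  | add a b ha hb =>
    intro h hh
    rw [map_add, add_mul]
    exact add _ _ (ha _ hh) (hb _ hh)

/-- Linear identities on `H_q` can thus be tested on words. Neither linear independence of words nor
uniqueness of the degree is ever needed. -/
lemma span_isMonomial : Submodule.span k {h | ∃ n, IsMonomial k q n h} = ⊤ := by
  rw [eq_top_iff]
  rintro x -
  induction x using induction_gen_mul with
  | one => exact Submodule.subset_span ⟨0, .one⟩
  | add x y hx hy => exact Submodule.add_mem _ hx hy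
  | smul c x hx => exact Submodule.smul_mem _ c hx
  | gen_mul g x hx =>
    induction hx using Submodule.span_induction with
    | zero => simp
    | add x y _ _ hx hy => rw [mul_add]; exact Submodule.add_mem _ hx hy
    | smul c x _ hx => rw [mul_smul_comm]; exact Submodule.smul_mem _ c hx
    | mem x hx =>
      obtain ⟨n, hx⟩ := hx
      apply Submodule.subset_span
      match g with
      | .D 0 => exact ⟨_, hx.D_zero_mul⟩
      | .D 1 => exact ⟨_, hx.D_one_mul⟩
      | .sigma => exact ⟨_, hx.sigma_mul⟩
      | .sigmaInv => exact ⟨_, hx.sigmaInv_mul⟩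

variable {k q}

lemma ext_isMonomial {M : Type*} [AddCommMonoid M] [Module k M] {φ ψ : Hq k q →ₗ[k] M}
    (H : ∀ n h, IsMonomial k q n h → φ h = ψ h) : φ = ψ :=
  LinearMap.ext_on (span_isMonomial k q) fun h ⟨n, hn⟩ => H n h hn

lemma tensor_ext_isMonomial {M : Type*} [AddCommMonoid M] [Module k M]
    {φ ψ : Hq k q ⊗[k] Hq k q →ₗ[k] M}
    (H : ∀ x n y, IsMonomial k q n y → φ (x ⊗ₜ y) = ψ (x ⊗ₜ y)) : φ = ψ :=
  TensorProduct.ext (LinearMap.ext fun x => ext_isMonomial fun n y hy => H x n y hy)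

lemma IsMonomial.mul {m n : ℤ} {x y : Hq k q} (hx : IsMonomial k q m x)
    (hy : IsMonomial k q n y) : IsMonomial k q (m + n) (x * y) := by
  induction hx with
  | one => simpa using hy
  | sigma_mul _ ih => rw [mul_assoc]; exact ih.sigma_mul
  | sigmaInv_mul _ ih => rw [mul_assoc]; exact ih.sigmaInv_mul
  | D_zero_mul _ ih => rw [mul_assoc, add_assoc]; exact ih.D_zero_mul
  | D_one_mul _ ih => rw [mul_assoc, add_assoc]; exact ih.D_one_mul

lemma comul_eq (h : Hq k q) : Coalgebra.comul (R := k) h = comulHom k q h := rfl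

lemma counit_eq (h : Hq k q) : Coalgebra.counit (R := k) h = counitHom k q h := rfl

lemma IsMonomial.counit {n : ℤ} {h : Hq k q} (hh : IsMonomial k q n h) :
    n = 0 ∨ counitHom k q h = 0 := by
  induction hh with
  | one => simp
  | sigma_mul _ ih => simpa using ih
  | sigmaInv_mul _ ih => simpa using ih
  | D_zero_mul _ ih => simp
  | D_one_mul _ ih => simp

/-- Each generator has a coproduct of total degree equal to its own degree, and `Δ` is
multiplicative. This makes the transposition compatible with `Δ`: on each term `αˡ` and `αᵐ` compose
to `αⁿ`. -/
lemma IsMonomial.comul {n : ℤ} {h : Hq k q} (hh : IsMonomial k q n h) :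
    comulHom k q h ∈ Submodule.span k {z : Hq k q ⊗[k] Hq k q | ∃ l m x y, l + m = n ∧
      IsMonomial k q l x ∧ IsMonomial k q m y ∧ z = x ⊗ₜ y} := by
  have key : ∀ {n n' : ℤ} {z w : Hq k q ⊗[k] Hq k q},
      (∀ l m x y, IsMonomial k q l x → IsMonomial k q m y → l + m = n →
        w * x ⊗ₜ y ∈ Submodule.span k {z : Hq k q ⊗[k] Hq k q | ∃ l m x y, l + m = n' ∧
          IsMonomial k q l x ∧ IsMonomial k q m y ∧ z = x ⊗ₜ y}) →
      z ∈ Submodule.span k {z : Hq k q ⊗[k] Hq k q | ∃ l m x y, l + m = n ∧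
        IsMonomial k q l x ∧ IsMonomial k q m y ∧ z = x ⊗ₜ y} →
      w * z ∈ Submodule.span k {z : Hq k q ⊗[k] Hq k q | ∃ l m x y, l + m = n' ∧
        IsMonomial k q l x ∧ IsMonomial k q m y ∧ z = x ⊗ₜ y} := by
    intro n n' z w hw hz
    induction hz using Submodule.span_induction with
    | zero => simp
    | add x y _ _ hx hy => rw [mul_add]; exact Submodule.add_mem _ hx hy
    | smul c x _ hx => rw [mul_smul_comm]; exact Submodule.smul_mem _ c hx
    | mem z hz =>
      obtain ⟨l, m, x, y, hlm, hx, hy, rfl⟩ := hz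
      exact hw l m x y hx hy hlm
  induction hh with
  | one => exact Submodule.subset_span ⟨0, 0, 1, 1, rfl, .one, .one, map_one _⟩
  | sigma_mul _ ih =>
    rw [map_mul]
    refine key (fun l m x y hx hy hlm => Submodule.subset_span ?_) ih
    exact ⟨_, _, _, _, hlm, hx.sigma_mul, hy.sigma_mul, by simp⟩
  | sigmaInv_mul _ ih =>
    rw [map_mul]
    refine key (fun l m x y hx hy hlm => Submodule.subset_span ?_) ih
    exact ⟨_, _, _, _, hlm, hx.sigmaInv_mul, hy.sigmaInv_mul, by simp⟩
  | D_zero_mul _ ih =>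
    rw [map_mul]
    refine key (fun l m x y hx hy hlm => ?_) ih
    rw [comulHom_D_zero, add_mul, Algebra.TensorProduct.tmul_mul_tmul,
      Algebra.TensorProduct.tmul_mul_tmul, one_mul]
    refine Submodule.add_mem _ (Submodule.subset_span ?_) (Submodule.subset_span ?_)
    · exact ⟨_, _, _, _, by omega, hx.D_zero_mul, hy.sigma_mul, rfl⟩
    · exact ⟨_, _, _, _, by omega, hx, hy.D_zero_mul, rfl⟩
  | D_one_mul _ ih =>
    rw [map_mul]
    refine key (fun l m x y hx hy hlm => ?_) ih
    rw [comulHom_D_one, add_mul, Algebra.TensorProduct.tmul_mul_tmul,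
      Algebra.TensorProduct.tmul_mul_tmul, one_mul]
    refine Submodule.add_mem _ (Submodule.subset_span ?_) (Submodule.subset_span ?_)
    · exact ⟨_, _, _, _, by omega, hx.D_one_mul, hy, rfl⟩
    · exact ⟨_, _, _, _, by omega, hx.sigma_mul, hy.D_one_mul, rfl⟩

end Monomial

end Hq

section GoodTransposition

open Hq

variable {k : Type u} [Field k] {q : kˣ} {A : Type w} [Ring A] [Algebra k A]

lemma goodHom_of_isMonomial (α : A ≃ₗ[k] A) {n : ℤ} {h : Hq k q} (hh : IsMonomial k q n h) :
    goodHom q α h = ((α ^ n : A ≃ₗ[k] A).toLinearMap : Module.End k A) ⊗ₜ h := by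
  induction hh with
  | one => exact map_one _
  | sigma_mul _ ih => rw [map_mul, ih]; simp [goodHom]
  | sigmaInv_mul _ ih => rw [map_mul, ih]; simp [goodHom]
  | D_zero_mul _ ih =>
    rw [map_mul, ih, zpow_one_add]
    simp [goodHom]
  | D_one_mul _ ih =>
    rw [map_mul, ih, zpow_add, zpow_neg_one]
    simp [goodHom]
    rfl

lemma goodTransposition_tmul (α : A ≃ₗ[k] A) (h : Hq k q) (a : A) :
    goodTransposition q α (h ⊗ₜ a) =
      (LinearMap.applyₗ a : Module.End k A →ₗ[k] A).rTensor (Hq k q) (goodHom q α h) := rfl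

/-- With this formula the transposition axioms become identities between powers of `α`. -/
lemma goodTransposition_of_isMonomial (α : A ≃ₗ[k] A) {n : ℤ} {h : Hq k q}
    (hh : IsMonomial k q n h) (a : A) :
    goodTransposition q α (h ⊗ₜ a) = (α ^ n) a ⊗ₜ h := by
  rw [goodTransposition_tmul, goodHom_of_isMonomial α hh]
  rfl

/-- The inverse is the good transposition of `α⁻¹`, conjugated by the flip of the tensor factors. -/
lemma goodTransposition_bijective (α : A ≃ₗ[k] A) :
    Function.Bijective (goodTransposition q α) := by
  have h1 : ((TensorProduct.comm k A (Hq k q)).toLinearMap ∘ₗ goodTransposition q α.symm ∘ₗ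
      (TensorProduct.comm k A (Hq k q)).toLinearMap) ∘ₗ goodTransposition q α = LinearMap.id := by
    refine TensorProduct.ext (ext_isMonomial fun n h hh => LinearMap.ext fun a => ?_)
    have : (α.symm ^ n) ((α ^ n) a) = a := by
      change ((α⁻¹ ^ n * α ^ n : A ≃ₗ[k] A)) a = a
      rw [inv_zpow, inv_mul_cancel]
      rfl
    simp [goodTransposition_of_isMonomial _ hh, this]
  have h2 : goodTransposition q α ∘ₗ ((TensorProduct.comm k A (Hq k q)).toLinearMap ∘ₗ
      goodTransposition q α.symm ∘ₗ (TensorProduct.comm k A (Hq k q)).toLinearMap) =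
        LinearMap.id := by
    refine TensorProduct.ext' fun a h => ?_
    suffices H : ((goodTransposition q α ∘ₗ ((TensorProduct.comm k A (Hq k q)).toLinearMap ∘ₗ
      goodTransposition q α.symm ∘ₗ (TensorProduct.comm k A (Hq k q)).toLinearMap)) ∘ₗ
        TensorProduct.mk k A (Hq k q) a) = TensorProduct.mk k A (Hq k q) a from
      LinearMap.congr_fun H h
    refine ext_isMonomial fun n h hh => ?_
    have : (α ^ n) ((α.symm ^ n) a) = a := by
      change ((α ^ n * α⁻¹ ^ n : A ≃ₗ[k] A)) a = a
      rw [inv_zpow, mul_inv_cancel]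
      rfl
    simp [goodTransposition_of_isMonomial _ hh, this]
  exact Function.bijective_iff_has_inverse.mpr ⟨⇑((TensorProduct.comm k A (Hq k q)).toLinearMap ∘ₗ
    goodTransposition q α.symm ∘ₗ (TensorProduct.comm k A (Hq k q)).toLinearMap),
    fun z => LinearMap.congr_fun h1 z, fun z => LinearMap.congr_fun h2 z⟩

lemma zpow_map_one {α : A ≃ₗ[k] A} (h1 : α 1 = 1) (n : ℤ) : (α ^ n) 1 = 1 := by
  have h1' : (α⁻¹ : A ≃ₗ[k] A) 1 = 1 := α.symm_apply_eq.mpr h1.symm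
  induction n using Int.induction_on with
  | zero => rfl
  | succ n ih => rw [zpow_add_one, LinearEquiv.mul_apply, h1, ih]
  | pred n ih => rw [zpow_sub_one, LinearEquiv.mul_apply, h1', ih]

lemma zpow_map_mul {α : A ≃ₗ[k] A} (hm : ∀ a b, α (a * b) = α a * α b) (n : ℤ) (a b : A) :
    (α ^ n) (a * b) = (α ^ n) a * (α ^ n) b := by
  have hm' : ∀ a b, (α⁻¹ : A ≃ₗ[k] A) (a * b) = α⁻¹ a * α⁻¹ b := fun a b =>
    α.symm_apply_eq.mpr (by
      rw [hm]
      exact congrArg₂ (· * ·) (α.apply_symm_apply a).symm (α.apply_symm_apply b).symm)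
  induction n using Int.induction_on generalizing a b with
  | zero => rfl
  | succ n ih => simp only [zpow_add_one, LinearEquiv.mul_apply, hm, ih]
  | pred n ih => simp only [zpow_sub_one, LinearEquiv.mul_apply, hm', ih]

/-- On words, the product and coproduct axioms express additivity of exponents, the braid axiom that
powers of `α` commute, and the counit axiom that `ε` vanishes on words unless the degree is zero.
Only the two axioms on `A` use that `α` is unital and multiplicative. -/
lemma isLeftTransposition_goodTransposition {α : A ≃ₗ[k] A} (h1 : α 1 = 1)
    (hm : ∀ a b, α (a * b) = α a * α b) : IsLeftTransposition (goodTransposition q α) where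
  bijective := goodTransposition_bijective α
  unit_left a := by rw [goodTransposition_of_isMonomial α .one]; rfl
  mul_left := by
    refine TensorProduct.ext (ext_isMonomial fun n h hh => TensorProduct.ext
      (ext_isMonomial fun m h' hh' => LinearMap.ext fun a => ?_))
    simp [slideHH, goodTransposition_of_isMonomial _ hh, goodTransposition_of_isMonomial _ hh',
      goodTransposition_of_isMonomial _ (hh.mul hh'), zpow_add]
  counit_left := by
    refine TensorProduct.ext (ext_isMonomial fun n h hh => LinearMap.ext fun a => ?_)
    rcases hh.counit with rfl | h0
    · simp [goodTransposition_of_isMonomial _ hh]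
    · simp [goodTransposition_of_isMonomial _ hh, counit_eq, h0]
  comul_left := by
    refine TensorProduct.ext (ext_isMonomial fun n h hh => LinearMap.ext fun a => ?_)
    have key : ∀ z ∈ Submodule.span k {z : Hq k q ⊗[k] Hq k q | ∃ l m x y, l + m = n ∧
        IsMonomial k q l x ∧ IsMonomial k q m y ∧ z = x ⊗ₜ y},
        slideHH (goodTransposition q α) (TensorProduct.assoc k _ _ _ (z ⊗ₜ a)) =
          (α ^ n) a ⊗ₜ z := by
      intro z hz
      induction hz using Submodule.span_induction with
      | zero => simp
      | add x y _ _ hx hy => rw [TensorProduct.add_tmul, map_add, map_add, hx, hy,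
          TensorProduct.tmul_add]
      | smul c x _ hx => rw [← TensorProduct.smul_tmul', map_smul, map_smul, hx,
          TensorProduct.tmul_smul]
      | mem z hz =>
        obtain ⟨l, m, x, y, rfl, hx, hy, rfl⟩ := hz
        simp [slideHH, goodTransposition_of_isMonomial _ hx, goodTransposition_of_isMonomial _ hy,
          zpow_add]
    simp [goodTransposition_of_isMonomial _ hh, comul_eq, key _ hh.comul]
  braid := by
    refine TensorProduct.ext (ext_isMonomial fun n h hh => TensorProduct.ext
      (ext_isMonomial fun m h' hh' => LinearMap.ext fun a => ?_))
    have : (α ^ m) ((α ^ n) a) = (α ^ n) ((α ^ m) a) := by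
      rw [← LinearEquiv.mul_apply, ← LinearEquiv.mul_apply, ← zpow_add, ← zpow_add, add_comm]
    simp [slideHH, flipHH, goodTransposition_of_isMonomial _ hh,
      goodTransposition_of_isMonomial _ hh', this]
  unit_right h := by
    suffices H : goodTransposition q α ∘ₗ (TensorProduct.mk k (Hq k q) A).flip 1 =
        TensorProduct.mk k A (Hq k q) 1 from LinearMap.congr_fun H h
    refine ext_isMonomial fun n h hh => ?_
    simp [goodTransposition_of_isMonomial _ hh, zpow_map_one h1]
  mul_right := by
    refine TensorProduct.ext (ext_isMonomial fun n h hh => TensorProduct.ext'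
      fun a b => ?_)
    simp [slideAA, goodTransposition_of_isMonomial _ hh, zpow_map_mul hm]

/-! ### `H_q`-module algebras for a good transposition -/

/-- `D` is a `(φ, ψ)`-skew derivation: `D(ab) = D(a) ψ(b) + φ(a) D(b)`. -/
def IsSkewDer (φ ψ D : A →ₗ[k] A) : Prop :=
  ∀ a b, D (a * b) = D a * ψ b + φ a * D b

lemma IsSkewDer.apply_one {φ ψ D : A →ₗ[k] A} (hD : IsSkewDer φ ψ D) (hφ : φ 1 = 1)
    (hψ : ψ 1 = 1) : D 1 = 0 := by
  have := hD 1 1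
  rw [mul_one, hφ, hψ, mul_one, one_mul] at this
  exact left_eq_add.mp this

lemma commute_zpow {α : A ≃ₗ[k] A} {T : Module.End k A} (h : ∀ a, T (α a) = α (T a)) (n : ℤ)
    (a : A) : T ((α ^ n) a) = (α ^ n) (T a) := by
  have h' : ∀ a, T ((α⁻¹ : A ≃ₗ[k] A) a) = α⁻¹ (T a) := fun a =>
    (α.symm_apply_eq.mpr (by rw [← h]; exact congrArg T (α.apply_symm_apply a).symm)).symm
  induction n using Int.induction_on generalizing a with
  | zero => rfl
  | succ n ih => simp only [zpow_add_one, LinearEquiv.mul_apply, h, ih]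
  | pred n ih => simp only [zpow_sub_one, LinearEquiv.mul_apply, h', ih]

/-- The operators commuting with `α` are closed under sums, products and inverses, so `σ⁻¹` needs no
hypothesis of its own. -/
lemma act_commute {α : A ≃ₗ[k] A} {act : Hq k q →ₐ[k] Module.End k A}
    (hσ : ∀ a, act (sigma k q) (α a) = α (act (sigma k q) a))
    (hD : ∀ i a, act (D k q i) (α a) = α (act (D k q i) a)) (h : Hq k q) (a : A) :
    act h (α a) = α (act h a) := by
  have hσ' : ∀ a, act (sigmaInv k q) (α a) = α (act (sigmaInv k q) a) := by
    intro a
    have e1 : ∀ a, act (sigma k q) (act (sigmaInv k q) a) = a := fun a => by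
      rw [← Module.End.mul_apply, ← map_mul, sigma_mul_sigmaInv, map_one, Module.End.one_apply]
    have e2 : ∀ a, act (sigmaInv k q) (act (sigma k q) a) = a := fun a => by
      rw [← Module.End.mul_apply, ← map_mul, sigmaInv_mul_sigma, map_one, Module.End.one_apply]
    rw [← e2 (α (act (sigmaInv k q) a)), hσ, e1]
  induction h using induction_gen_mul generalizing a with
  | one => simp
  | add x y hx hy => simp [hx, hy]
  | smul c x hx => simp [hx]
  | gen_mul g x hx =>
    rw [map_mul, Module.End.mul_apply, hx, Module.End.mul_apply]
    cases g with
    | D i => exact hD i _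
    | sigma => exact hσ _
    | sigmaInv => exact hσ' _

lemma actionMap_tmul {H : Type v} [Ring H] [Bialgebra k H] (act : H →ₐ[k] Module.End k A)
    (h : H) (a : A) : actionMap act (h ⊗ₜ a) = act h a := rfl

/-- Operators `σ`, `D₁`, `D₂` with the twisted Leibniz rules give a module algebra. -/
theorem isModuleAlgebra_of_isSkewDer {α : A ≃ₗ[k] A} (h1 : α 1 = 1)
    (hm : ∀ a b, α (a * b) = α a * α b) {act : Hq k q →ₐ[k] Module.End k A}
    (hσ1 : act (sigma k q) 1 = 1)
    (hσm : ∀ a b, act (sigma k q) (a * b) = act (sigma k q) a * act (sigma k q) b)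
    (hσα : ∀ a, act (sigma k q) (α a) = α (act (sigma k q) a))
    (hDα : ∀ i a, act (D k q i) (α a) = α (act (D k q i) a))
    (hD₀ : IsSkewDer α.toLinearMap (act (sigma k q)) (act (D k q 0)))
    (hD₁ : IsSkewDer (act (sigma k q) ∘ₗ α.symm.toLinearMap) LinearMap.id (act (D k q 1))) :
    IsModuleAlgebra (goodTransposition q α) act := by
  have e1 : ∀ a, act (sigma k q) (act (sigmaInv k q) a) = a := fun a => by
    rw [← Module.End.mul_apply, ← map_mul, sigma_mul_sigmaInv, map_one, Module.End.one_apply]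
  have e2 : ∀ a, act (sigmaInv k q) (act (sigma k q) a) = a := fun a => by
    rw [← Module.End.mul_apply, ← map_mul, sigmaInv_mul_sigma, map_one, Module.End.one_apply]
  have hτm : ∀ a b, act (sigmaInv k q) (a * b) = act (sigmaInv k q) a * act (sigmaInv k q) b := by
    intro a b
    rw [← e2 (act (sigmaInv k q) a * act (sigmaInv k q) b), hσm, e1, e1]
  have hcomm := act_commute hσα hDα
  refine ⟨isLeftTransposition_goodTransposition h1 hm, ?_, ?_, ?_⟩
  · refine TensorProduct.ext (ext_isMonomial fun n h hh => TensorProduct.ext' fun h' a => ?_)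
    simp [flipHH, goodTransposition_of_isMonomial _ hh, actionMap_tmul,
      commute_zpow (hcomm h')]
  -- For fixed `a` and `b` the right-hand side is a linear function `Φ` of `Δ(h)`. It intertwines
  -- left multiplication by `Δ(g)` with the action of each generator `g`, so the rule passes from
  -- `x` to `g x`, starting from `x = 1`.
  · have key : ∀ (h : Hq k q) (a b : A), act h (a * b) =
        (LinearMap.mul' k A ∘ₗ TensorProduct.map (actionMap act) (actionMap act) ∘ₗ
          slideMid (goodTransposition q α)) (comulHom k q h ⊗ₜ (a ⊗ₜ b)) := by
      intro h a b
      obtain ⟨Φ, hΦ⟩ : ∃ Φ : Hq k q ⊗[k] Hq k q →ₗ[k] A, ∀ z, (LinearMap.mul' k A ∘ₗ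
          TensorProduct.map (actionMap act) (actionMap act) ∘ₗ
          slideMid (goodTransposition q α)) (z ⊗ₜ (a ⊗ₜ b)) = Φ z :=
        ⟨(LinearMap.mul' k A ∘ₗ TensorProduct.map (actionMap act) (actionMap act) ∘ₗ
          slideMid (goodTransposition q α)) ∘ₗ
            (TensorProduct.mk k (Hq k q ⊗[k] Hq k q) (A ⊗[k] A)).flip (a ⊗ₜ b), fun z => rfl⟩
      -- Only the second tensor factor is moved past `a`, so only that factor has to be a word.
      have hom : ∀ (x : Hq k q) {n : ℤ} {y : Hq k q}, IsMonomial k q n y →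
          Φ (x ⊗ₜ y) = act x ((α ^ n) a) * act y b := by
        intro x n y hy
        rw [← hΦ]
        simp [slideMid, goodTransposition_of_isMonomial _ hy, actionMap_tmul]
      rw [hΦ]
      have step : ∀ g : Gen, ∀ z : Hq k q ⊗[k] Hq k q,
          act (gen k q g) (Φ z) = Φ (comulHom k q (gen k q g) * z) := by
        intro g
        suffices H : act (gen k q g) ∘ₗ Φ = Φ ∘ₗ LinearMap.mulLeft k (comulHom k q (gen k q g)) from
          fun z => LinearMap.congr_fun H z
        refine tensor_ext_isMonomial fun x n y hy => ?_
        rw [LinearMap.comp_apply, LinearMap.comp_apply, LinearMap.mulLeft_apply, hom x hy]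
        match g with
        | .D 0 =>
          rw [hD₀, comulHom_D_zero, add_mul, map_add,
            Algebra.TensorProduct.tmul_mul_tmul, Algebra.TensorProduct.tmul_mul_tmul,
            hom _ hy.sigma_mul, hom _ hy.D_zero_mul]
          simp [zpow_add, hcomm]
        | .D 1 =>
          have hcomm' : ∀ h a, act h (α.symm a) = α.symm (act h a) := fun h a => by
            have := commute_zpow (hcomm h) (-1) a
            rwa [zpow_neg_one] at this
          rw [hD₁, comulHom_D_one, add_mul, map_add,
            Algebra.TensorProduct.tmul_mul_tmul, Algebra.TensorProduct.tmul_mul_tmul,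
            one_mul, hom _ hy, hom _ hy.D_one_mul]
          simp [zpow_add, hcomm']
        | .sigma =>
          rw [comulHom_sigma, Algebra.TensorProduct.tmul_mul_tmul, hom _ hy.sigma_mul, hσm]
          simp
        | .sigmaInv =>
          rw [comulHom_sigmaInv, Algebra.TensorProduct.tmul_mul_tmul, hom _ hy.sigmaInv_mul, hτm]
          simp
      induction h using induction_gen_mul with
      | one =>
        rw [map_one act, map_one (comulHom k q), Algebra.TensorProduct.one_def, hom 1 .one]
        simp
      | add x y hx hy => rw [map_add, LinearMap.add_apply, hx, hy, map_add, map_add]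
      | smul c x hx => rw [map_smul, LinearMap.smul_apply, hx, map_smul, map_smul]
      | gen_mul g x hx => rw [map_mul act, Module.End.mul_apply, hx, step, map_mul (comulHom k q)]
    refine TensorProduct.ext (LinearMap.ext fun h => TensorProduct.ext' fun a b => ?_)
    exact key h a b
  · intro h
    have hD0 : ∀ i, act (D k q i) 1 = 0 := fun i => by
      match i with
      | 0 => exact hD₀.apply_one h1 hσ1
      | 1 => exact hD₁.apply_one ((congrArg _ (α.symm_apply_eq.mpr h1.symm)).trans hσ1) rfl
    have hτ1 : act (sigmaInv k q) 1 = 1 := by rw [← hσ1, e2, hσ1]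
    rw [counit_eq]
    induction h using induction_gen_mul with
    | one => simp
    | add x y hx hy => simp [hx, hy, add_smul]
    | smul c x hx => simp [hx, smul_smul]
    | gen_mul g x hx =>
      rw [map_mul, Module.End.mul_apply, hx, map_smul, map_mul]
      cases g with
      | D i => simp [hD0]
      | sigma => simp [hσ1]
      | sigmaInv => simp [hτ1]

/-! ### Skew derivations extracted from a module algebra -/

section Necessary

variable {α : A ≃ₗ[k] A} {act : Hq k q →ₐ[k] Module.End k A}

lemma IsModuleAlgebra.sigma_mul (H : IsModuleAlgebra (goodTransposition q α) act) (a b : A) :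
    act (sigma k q) (a * b) = act (sigma k q) a * act (sigma k q) b := by
  have := LinearMap.congr_fun H.act_mul (sigma k q ⊗ₜ (a ⊗ₜ b))
  simpa [slideMid, goodTransposition_sigma, comul_eq, actionMap_tmul] using this

lemma IsModuleAlgebra.sigma_one (H : IsModuleAlgebra (goodTransposition q α) act) :
    act (sigma k q) 1 = 1 := by
  simpa [counit_eq] using H.act_one (sigma k q)

lemma IsModuleAlgebra.isSkewDer_D_zero (H : IsModuleAlgebra (goodTransposition q α) act) :
    IsSkewDer α.toLinearMap (act (sigma k q)) (act (D k q 0)) := fun a b => by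
  have := LinearMap.congr_fun H.act_mul (D k q 0 ⊗ₜ (a ⊗ₜ b))
  simpa [slideMid, goodTransposition_sigma, goodTransposition_D_zero, comul_eq, actionMap_tmul,
    TensorProduct.add_tmul] using this

lemma IsModuleAlgebra.isSkewDer_D_one (H : IsModuleAlgebra (goodTransposition q α) act) :
    IsSkewDer (act (sigma k q) ∘ₗ α.symm.toLinearMap) LinearMap.id (act (D k q 1)) := fun a b => by
  have := LinearMap.congr_fun H.act_mul (D k q 1 ⊗ₜ (a ⊗ₜ b))
  simpa [slideMid, H.transposition.unit_left, goodTransposition_D_one, comul_eq, actionMap_tmul,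
    TensorProduct.add_tmul] using this

/-- The compatibility of `s` with the action at `D₁ ⊗ h ⊗ a` reads `α(h·a) ⊗ D₁ = h·α(a) ⊗ D₁`. A
linear functional taking the value `1` at `D₁` removes the second factor; it exists because an
element acting nontrivially is nonzero in `H_q`. -/
lemma IsModuleAlgebra.commute (H : IsModuleAlgebra (goodTransposition q α) act)
    (hD : act (D k q 0) ≠ 0) (h : Hq k q) (a : A) : act h (α a) = α (act h a) := by
  have hD' : D k q 0 ≠ 0 := fun h0 => hD (by rw [h0, map_zero])
  have := LinearMap.congr_fun H.compat (D k q 0 ⊗ₜ (h ⊗ₜ a))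
  have h' : α (act h a) ⊗ₜ D k q 0 = act h (α a) ⊗ₜ[k] D k q 0 := by
    simpa [flipHH, goodTransposition_D_zero, actionMap_tmul] using this
  obtain ⟨φ, hφ⟩ := Module.Projective.exists_dual_eq_one k hD'
  simpa [hφ] using (congrArg (TensorProduct.rid k A ∘ φ.lTensor A) h').symm

end Necessary

end GoodTransposition

/-! ### Twisted derivations on the symmetric algebra -/

section Sym

variable {k : Type u} [Field k] {V : Type w} [AddCommGroup V] [Module k V]

/-- The universal property of `S(V)` for maps into a not necessarily commutative algebra. -/
lemma exists_symmetricAlgebra_algHom {B : Type*} [Ring B] [Algebra k B] (φ : V →ₗ[k] B)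
    (h : ∀ v w, φ v * φ w = φ w * φ v) :
    ∃ F : SymmetricAlgebra k V →ₐ[k] B, ∀ v, F (SymmetricAlgebra.ι k V v) = φ v := by
  -- The universal property of `S(V)` requires a commutative target; the subalgebra generated by the
  -- commuting values of `φ` is one.
  have hc : IsMulCommutative (Algebra.adjoin k (Set.range φ)) :=
    Algebra.isMulCommutative_adjoin k (by rintro _ ⟨v, rfl⟩ _ ⟨w, rfl⟩; exact h v w)
  let _ : CommSemiring (Algebra.adjoin k (Set.range φ)) :=
    { (Algebra.adjoin k (Set.range φ)).toSemiring with mul_comm := hc.is_comm.comm }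
  let ψ : V →ₗ[k] Algebra.adjoin k (Set.range φ) :=
    φ.codRestrict (Subalgebra.toSubmodule (Algebra.adjoin k (Set.range φ)))
      fun v => Algebra.subset_adjoin (Set.mem_range_self v)
  exact ⟨(Algebra.adjoin k (Set.range φ)).val.comp (SymmetricAlgebra.lift ψ), fun v => by
    rw [AlgHom.comp_apply, SymmetricAlgebra.lift_ι_apply]; rfl⟩

/-- Twisted derivations from `S(V)` to an algebra `B`, along two algebra maps `a, b : S(V) → B`,
with prescribed values on `V`. -/
lemma exists_twisted_derivation {B : Type*} [Ring B] [Algebra k B]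
    (a b : SymmetricAlgebra k V →ₐ[k] B) (δ : V →ₗ[k] B)
    (h : ∀ v w, a (SymmetricAlgebra.ι k V v) * δ w + δ v * b (SymmetricAlgebra.ι k V w) =
      a (SymmetricAlgebra.ι k V w) * δ v + δ w * b (SymmetricAlgebra.ι k V v)) :
    ∃ d : SymmetricAlgebra k V →ₗ[k] B, (∀ v, d (SymmetricAlgebra.ι k V v) = δ v) ∧
      ∀ P Q, d (P * Q) = d P * b Q + a P * d Q := by
  have hcomm : ∀ (c : SymmetricAlgebra k V →ₐ[k] B) P Q, c P * c Q = c Q * c P := fun c P Q => by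
    rw [← map_mul, mul_comm, map_mul]
  -- The upper right entry of a product of matrices with rows `(a, d)` and `(0, b)` is `a(P) d(Q) +
  -- d(P) b(Q)`, the twisted Leibniz rule. The hypothesis `h` says that these matrices commute on
  -- `V`.
  let φ : V →ₗ[k] Matrix (Fin 2) (Fin 2) B :=
    { toFun := fun v => !![a (SymmetricAlgebra.ι k V v), δ v; 0, b (SymmetricAlgebra.ι k V v)]
      map_add' := fun v w => by ext i j; fin_cases i <;> fin_cases j <;> simp
      map_smul' := fun c v => by ext i j; fin_cases i <;> fin_cases j <;> simp }
  obtain ⟨F, hF⟩ := exists_symmetricAlgebra_algHom φ (fun v w => by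
    change !![_, _; _, _] * !![_, _; _, _] = !![_, _; _, _] * !![_, _; _, _]
    rw [Matrix.mul_fin_two, Matrix.mul_fin_two]
    simp [hcomm a (SymmetricAlgebra.ι k V v), hcomm b (SymmetricAlgebra.ι k V v), h v w])
  have hF' : ∀ P, F P 0 0 = a P ∧ F P 1 0 = 0 ∧ F P 1 1 = b P := by
    intro P
    induction P using SymmetricAlgebra.induction with
    | algebraMap r => simp [Matrix.algebraMap_matrix_apply]
    | ι x => rw [hF]; exact ⟨rfl, rfl, rfl⟩
    | mul P Q hP hQ => simp [Matrix.mul_apply, hP, hQ]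
    | add P Q hP hQ => simp [hP, hQ]
  refine ⟨⟨⟨fun P => F P 0 1, fun P Q => by simp⟩, fun c P => by simp⟩, fun v => ?_, fun P Q => ?_⟩
  · change F _ 0 1 = _
    rw [hF]; rfl
  · change F _ 0 1 = F P 0 1 * _ + _ * F Q 0 1
    rw [map_mul, Matrix.mul_apply, Fin.sum_univ_two, (hF' P).1, (hF' Q).2.2, add_comm]

lemma prod_Iio_fin_succ {M : Type*} [CommMonoid M] {n : ℕ} (f : Fin (n + 1) → M) (j : Fin n) :
    ∏ i ∈ Finset.Iio j.succ, f i = f 0 * ∏ i ∈ Finset.Iio j, f i.succ := by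
  have : Finset.Iio j.succ = Finset.cons 0 ((Finset.Iio j).map (Fin.succEmb n)) (by simp) := by
    ext i
    refine Fin.cases ?_ (fun i => ?_) i <;> simp
  rw [this, Finset.prod_cons, Finset.prod_map]
  rfl

/-- The Leibniz formula for a twisted derivation. -/
lemma twisted_derivation_prod {B : Type*} [Ring B] [Algebra k B]
    {a b : SymmetricAlgebra k V →ₐ[k] B} {d : SymmetricAlgebra k V →ₗ[k] B}
    (hd : ∀ P Q, d (P * Q) = d P * b Q + a P * d Q) (m : ℕ)
    (x : Fin m → SymmetricAlgebra k V) :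
    d (∏ j, x j) = ∑ j, a (∏ i ∈ Finset.Iio j, x i) * d (x j) * b (∏ i ∈ Finset.Ioi j, x i) := by
  induction m with
  | zero =>
    have := hd 1 1
    rw [mul_one, map_one a, map_one b, mul_one, one_mul] at this
    simpa using this
  | succ m ih =>
    rw [Fin.prod_univ_succ, hd, ih, Fin.sum_univ_succ, Finset.mul_sum]
    congr 1
    · have : Finset.Iio (0 : Fin (m + 1)) = ∅ := by ext i; simp
      simp [this]
    · refine Finset.sum_congr rfl fun j _ => ?_
      rw [prod_Iio_fin_succ, Fin.prod_Ioi_succ, map_mul, mul_assoc, mul_assoc, mul_assoc]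

/-- Products of vectors, including the empty one, span `S(V)`. This is why the formulas for `δ₁` and
`δ₂` determine them. -/
lemma linearMap_ext_prod_ι {M : Type*} [AddCommMonoid M] [Module k M]
    {φ ψ : SymmetricAlgebra k V →ₗ[k] M}
    (h : ∀ (m : ℕ) (x : Fin m → V), φ (∏ j, SymmetricAlgebra.ι k V (x j)) =
      ψ (∏ j, SymmetricAlgebra.ι k V (x j))) : φ = ψ := by
  have hs : Submodule.span k {P | ∃ (m : ℕ) (x : Fin m → V),
      P = ∏ j, SymmetricAlgebra.ι k V (x j)} = ⊤ := by
    rw [eq_top_iff]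
    rintro P -
    induction P using SymmetricAlgebra.induction with
    | algebraMap r =>
      rw [Algebra.algebraMap_eq_smul_one]
      exact Submodule.smul_mem _ _ (Submodule.subset_span ⟨0, Fin.elim0, by simp⟩)
    | ι x => exact Submodule.subset_span ⟨1, fun _ => x, by simp⟩
    | add P Q hP hQ => exact Submodule.add_mem _ hP hQ
    | mul P Q hP hQ =>
      have := Submodule.mul_mem_mul hP hQ
      rw [Submodule.span_mul_span] at this
      refine Submodule.span_mono ?_ this
      rintro _ ⟨_, ⟨m, x, rfl⟩, _, ⟨n, y, rfl⟩, rfl⟩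
      exact ⟨m + n, Fin.append x y, by simp [Fin.prod_univ_add]⟩
  exact LinearMap.ext_on hs fun P ⟨m, x, hP⟩ => hP ▸ h m x

lemma symMap_injective {φ : V →ₗ[k] V} (hφ : Function.Bijective φ) :
    Function.Injective (symMap φ) := by
  let e := LinearEquiv.ofBijective φ hφ
  have : Function.LeftInverse (symMap e.symm.toLinearMap) (symMap φ) := fun P => by
    rw [symMap_comp_apply, show e.symm.toLinearMap ∘ₗ φ = LinearMap.id from
      LinearMap.ext e.symm_apply_apply, symMap_id]
    rfl
  exact this.injective

/-- A functional with value `1` at a nonzero `v` extends to an algebra map `S(V) → k`, so the image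
of `v` in `S(V)` is nonzero. -/
lemma ι_injective : Function.Injective (SymmetricAlgebra.ι k V) := by
  rw [injective_iff_map_eq_zero]
  intro v hv
  by_contra hne
  obtain ⟨φ, hφ⟩ := Module.Projective.exists_dual_eq_one k hne
  have := SymmetricAlgebra.lift_ι_apply φ v
  rw [hv, map_zero, hφ] at this
  exact zero_ne_one this

end Sym

/-! ### Algebra maps and skew derivations on generators of the crossed product -/

section Crossed

variable {k : Type u} [Field k] {G : Type v} [Group G] {V : Type w} [AddCommGroup V] [Module k V]
  {ρ : Representation k G V} {f : NormalCocycle k G}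

namespace CrossedProduct

lemma of_injective (g : G) : Function.Injective (of ρ f g) := Finsupp.single_injective g

lemma of_one_mul_of (g : G) (P Q : SymmetricAlgebra k V) :
    of ρ f 1 P * of ρ f g Q = of ρ f g (P * Q) := by
  simp [of_mul_of, f.one_left, show symMap (1 : V →ₗ[k] V) = AlgHom.id k _ from symMap_id]

lemma of_mul_of_one (g : G) (P Q : SymmetricAlgebra k V) :
    of ρ f g P * of ρ f 1 Q = of ρ f g (P * symMap (ρ g) Q) := by
  simp [of_mul_of, f.one_right]

variable (ρ f) in
/-- The inclusion `S(V) → S(V) #_f G`. -/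
def incl : SymmetricAlgebra k V →ₐ[k] CrossedProduct ρ f :=
  AlgHom.ofLinearMap (of ρ f 1) rfl fun P Q => (of_one_mul_of 1 P Q).symm

@[simp] lemma incl_apply (P : SymmetricAlgebra k V) : incl ρ f P = of ρ f 1 P := rfl

lemma of_eq_mul (g : G) (P : SymmetricAlgebra k V) :
    of ρ f g P = of ρ f 1 P * of ρ f g 1 := by rw [of_one_mul_of, mul_one]

lemma of_comm_ι (g : G) (v : V) :
    of ρ f g 1 * of ρ f 1 (SymmetricAlgebra.ι k V v) =
      of ρ f 1 (SymmetricAlgebra.ι k V (ρ g v)) * of ρ f g 1 := by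
  rw [of_mul_of_one, of_one_mul_of, symMap_ι, mul_one, one_mul]

variable (ρ f) in
/-- `v₁ ⋯ v_m w_g ↦ φ(v₁) ⋯ φ(v_m) χ(g) w_g` as an algebra map, for `φ` `k[G]`-linear and `χ` a
character. -/
def diagHom (φ : V →ₗ[k] V) (hφ : ∀ g v, φ (ρ g v) = ρ g (φ v)) (χ : G →* kˣ) :
    CrossedProduct ρ f →ₐ[k] CrossedProduct ρ f :=
  AlgHom.ofLinearMap (diag φ χ) (by simp [one_def, diag_of]) fun a b => by
    have hs : ∀ g Q, symMap φ (symMap (ρ g) Q) = symMap (ρ g) (symMap φ Q) := fun g Q => by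
      rw [symMap_comp_apply, symMap_comp_apply]
      exact congrArg (fun ψ => symMap ψ Q) (LinearMap.ext (hφ g))
    induction a using induction with
    | zero => simp
    | add a a' h h' => simp only [add_mul, map_add, h, h']
    | of g P =>
      induction b using induction with
      | zero => simp
      | add b b' h h' => simp only [mul_add, map_add, h, h']
      | of h Q =>
        simp only [of_mul_of, diag_of, map_smul, map_mul, hs, smul_mul_assoc, mul_smul_comm,
          smul_smul, Units.val_mul]
        congr 1
        ring

@[simp] lemma diagHom_of (φ : V →ₗ[k] V) (hφ : ∀ g v, φ (ρ g v) = ρ g (φ v)) (χ : G →* kˣ) (g : G)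
    (P : SymmetricAlgebra k V) :
    diagHom ρ f φ hφ χ (of ρ f g P) = (χ g : k) • of ρ f g (symMap φ P) := diag_of ..

variable (ρ f) in
lemma adjoin_generators : Algebra.adjoin k
    (Set.range (fun v => of ρ f 1 (SymmetricAlgebra.ι k V v)) ∪ Set.range fun g => of ρ f g 1) =
      ⊤ := by
  rw [eq_top_iff]
  rintro a -
  induction a using induction with
  | zero => exact Subalgebra.zero_mem _
  | add a b ha hb => exact Subalgebra.add_mem _ ha hb
  | of g P =>
    rw [of_eq_mul]
    refine Subalgebra.mul_mem _ ?_ (Algebra.subset_adjoin (Or.inr ⟨g, rfl⟩))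
    rw [← incl_apply]
    induction P using SymmetricAlgebra.induction with
    | algebraMap r => rw [AlgHom.commutes]; exact Subalgebra.algebraMap_mem _ r
    | ι v => exact Algebra.subset_adjoin (Or.inl ⟨v, rfl⟩)
    | mul P Q hP hQ => rw [map_mul]; exact Subalgebra.mul_mem _ hP hQ
    | add P Q hP hQ => rw [map_add]; exact Subalgebra.add_mem _ hP hQ

lemma algHom_ext {B : Type*} [Semiring B] [Algebra k B] {φ ψ : CrossedProduct ρ f →ₐ[k] B}
    (hv : ∀ v, φ (of ρ f 1 (SymmetricAlgebra.ι k V v)) = ψ (of ρ f 1 (SymmetricAlgebra.ι k V v)))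
    (hg : ∀ g, φ (of ρ f g 1) = ψ (of ρ f g 1)) : φ = ψ := by
  refine AlgHom.ext_of_adjoin_eq_top (adjoin_generators ρ f) ?_
  rintro _ (⟨v, rfl⟩ | ⟨g, rfl⟩)
  · exact hv v
  · exact hg g

/-- Skew derivations are determined by their values on the generators. -/
lemma isSkewDer_ext {φ ψ : CrossedProduct ρ f →ₐ[k] CrossedProduct ρ f}
    {E E' : CrossedProduct ρ f →ₗ[k] CrossedProduct ρ f}
    (hE : IsSkewDer φ.toLinearMap ψ.toLinearMap E)
    (hE' : IsSkewDer φ.toLinearMap ψ.toLinearMap E')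
    (hv : ∀ v, E (of ρ f 1 (SymmetricAlgebra.ι k V v)) = E' (of ρ f 1 (SymmetricAlgebra.ι k V v)))
    (hg : ∀ g, E (of ρ f g 1) = E' (of ρ f g 1)) : E = E' := by
  refine LinearMap.ext fun a => ?_
  have ha : a ∈ Algebra.adjoin k (Set.range (fun v => of ρ f 1 (SymmetricAlgebra.ι k V v)) ∪
    Set.range fun g => of ρ f g 1) := by rw [adjoin_generators]; trivial
  induction ha using Algebra.adjoin_induction with
  | mem a ha =>
    rcases ha with ⟨v, rfl⟩ | ⟨g, rfl⟩
    · exact hv v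
    · exact hg g
  | algebraMap r =>
    rw [Algebra.algebraMap_eq_smul_one, map_smul, map_smul,
      hE.apply_one (map_one φ) (map_one ψ), hE'.apply_one (map_one φ) (map_one ψ)]
  | add a b _ _ ha hb => rw [map_add, map_add, ha, hb]
  | mul a b _ _ ha hb => rw [hE, hE', ha, hb]

end CrossedProduct

open CrossedProduct

/-- This and the next lemma do the reordering in the two Leibniz summands of `E((P w_g)(Q w_h))`,
where `w = w_g` is moved past an element coming from `Q`. -/
lemma mul_mul_smul_mul_smul {A : Type*} [Ring A] [Algebra k A] {d x y w w' : A} {c c' : k}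
    (h : x * w = w * y) : d * x * ((c • w) * (c' • w')) = d * (c • w) * (c' • (y * w')) := by
  simp only [mul_smul_comm, smul_mul_assoc, mul_assoc]
  rw [← mul_assoc x, h, mul_assoc]

lemma mul_mul_smul_mul {A : Type*} [Ring A] [Algebra k A] {a x y w z : A} {c c' : k}
    (h : x * (c • w) = (c' • w) * y) : a * x * ((c • w) * z) = (c' • (a * w)) * (y * z) := by
  rw [mul_assoc, ← mul_assoc x, h]
  simp only [mul_smul_comm, smul_mul_assoc, mul_assoc]

/-- Extending a twisted derivation `S(V) → A` to a skew derivation of `A` that vanishes on the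
`w_g`. -/
lemma isSkewDer_liftLin {a b : V →ₗ[k] V} (ha : ∀ g v, a (ρ g v) = ρ g (a v))
    (hb : ∀ g v, b (ρ g v) = ρ g (b v)) {η θ : G →* kˣ}
    {d : SymmetricAlgebra k V →ₗ[k] CrossedProduct ρ f}
    (hd : ∀ P Q, d (P * Q) = d P * of ρ f 1 (symMap b Q) + of ρ f 1 (symMap a P) * d Q)
    (hG : ∀ g v, d (SymmetricAlgebra.ι k V (ρ g v)) * (θ g : k) • of ρ f g 1 =
      (η g : k) • of ρ f g 1 * d (SymmetricAlgebra.ι k V v)) :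
    IsSkewDer (diag a η) (diag b θ)
      (liftLin ρ f fun g => LinearMap.mulRight k ((θ g : k) • of ρ f g 1) ∘ₗ d) := by
  have hd1 : d 1 = 0 := by
    have := hd 1 1
    rw [mul_one, map_one (symMap a), map_one (symMap b), ← one_def, mul_one, one_mul] at this
    exact left_eq_add.mp this
  have hs : ∀ (c : V →ₗ[k] V), (∀ g v, c (ρ g v) = ρ g (c v)) → ∀ g Q,
      symMap c (symMap (ρ g) Q) = symMap (ρ g) (symMap c Q) := fun c hc g Q => by
    rw [symMap_comp_apply, symMap_comp_apply]
    exact congrArg (fun ψ => symMap ψ Q) (LinearMap.ext (hc g))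
  have hof : ∀ g Q, of ρ f 1 (symMap (ρ g) Q) * of ρ f g 1 = of ρ f g 1 * of ρ f 1 Q := by
    intro g Q
    rw [of_mul_of_one, of_one_mul_of, mul_one, one_mul]
  -- Both sides obey the same product rule in `Q`, so the relation `hG` spreads from `V` to all of
  -- `S(V)`.
  have hG' : ∀ g Q, d (symMap (ρ g) Q) * (θ g : k) • of ρ f g 1 =
      (η g : k) • of ρ f g 1 * d Q := by
    intro g Q
    induction Q using SymmetricAlgebra.induction with
    | algebraMap r => simp [Algebra.algebraMap_eq_smul_one, hd1]
    | ι v => rw [symMap_ι, hG]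
    | add P Q hP hQ => rw [map_add, map_add, map_add, add_mul, mul_add, hP, hQ]
    | mul P Q hP hQ =>
      rw [map_mul, hd, hd, hs a ha, hs b hb, add_mul, mul_add, mul_assoc (d _), mul_smul_comm,
        hof, ← smul_mul_assoc, ← mul_assoc, hP, mul_assoc, mul_assoc, hQ, smul_mul_assoc _ _ (d Q),
        mul_smul_comm, ← mul_assoc (of ρ f 1 _), hof, smul_mul_assoc _ (of ρ f g 1) (_ * _),
        mul_assoc (of ρ f g 1)]
      simp only [smul_mul_assoc]
  intro x y
  induction x using induction with
  | zero => simp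
  | add a a' h h' => simp only [add_mul, map_add, h, h']; abel
  | of g P =>
    induction y using induction with
    | zero => simp
    | add b b' h h' => simp only [mul_add, map_add, h, h']; abel
    | of h Q =>
      have hw : of ρ f g 1 * of ρ f h 1 = (f g h : k) • of ρ f (g * h) 1 := by
        simp [of_mul_of]
      rw [of_mul_of, map_smul, map_smul, liftLin_of, liftLin_of, liftLin_of, diag_of, diag_of,
        LinearMap.comp_apply, LinearMap.comp_apply, LinearMap.comp_apply, LinearMap.mulRight_apply,
        LinearMap.mulRight_apply, LinearMap.mulRight_apply, hd, hs b hb]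
      -- Multiplicativity of `θ` makes `θ(g) w_g` multiply with the same cocycle as `w_g`, so `f(g,
      -- h)` is absorbed.
      have e1 : (f g h : k) • ((θ (g * h) : k) • of ρ f (g * h) 1) =
          ((θ g : k) • of ρ f g 1) * ((θ h : k) • of ρ f h 1) := by
        rw [smul_mul_assoc, mul_smul_comm, hw, map_mul, Units.val_mul, smul_smul, smul_smul,
          smul_smul]
        congr 1
        ring
      rw [← mul_smul_comm, e1, add_mul, of_eq_mul h (symMap b Q), of_eq_mul g (symMap a P)]
      refine congrArg₂ (· + ·) ?_ ?_
      · exact mul_mul_smul_mul_smul (hof g _)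
      · exact mul_mul_smul_mul (hG' g Q)

end Crossed

/-! ### Comparison of coefficients of the `w_g` -/

section Crossed

variable {k : Type u} [Field k] {G : Type v} [Group G] {V : Type w} [AddCommGroup V] [Module k V]
  {ρ : Representation k G V} {f : NormalCocycle k G}

open CrossedProduct

namespace CrossedProduct

variable (ρ f) in
/-- The coefficient of `w_g`. -/
def coeff (g : G) : CrossedProduct ρ f →ₗ[k] SymmetricAlgebra k V := Finsupp.lapply g

lemma coeff_of [DecidableEq G] (g h : G) (P : SymmetricAlgebra k V) :
    coeff ρ f g (of ρ f h P) = if h = g then P else 0 := by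
  change Finsupp.single h P g = _
  rw [Finsupp.single_apply]

lemma coeff_sum_of [DecidableEq G] (S : Finset G) (F : G → SymmetricAlgebra k V) (g : G) :
    coeff ρ f g (∑ h ∈ S, of ρ f h (F h)) = if g ∈ S then F g else 0 := by
  simp [coeff_of]

lemma sum_of_injective {S : Finset G} {F F' : G → SymmetricAlgebra k V}
    (h : ∑ g ∈ S, of ρ f g (F g) = ∑ g ∈ S, of ρ f g (F' g)) : ∀ g ∈ S, F g = F' g := by
  classical
  intro g hg
  have := congrArg (coeff ρ f g) h
  rwa [coeff_sum_of, coeff_sum_of, if_pos hg, if_pos hg] at this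

end CrossedProduct

/-! ### The Leibniz formula for `δ₁` and `δ₂` -/

/-- Common form of the formulas for `δ₁` and `δ₂`. -/
def IsTwistedDelta (a b : V →ₗ[k] V) (θ : G → k) (δhat : V →ₗ[k] CrossedProduct ρ f)
    (δ : CrossedProduct ρ f →ₗ[k] CrossedProduct ρ f) : Prop :=
  ∀ (m : ℕ) (x : Fin m → V) (g : G),
    δ (of ρ f g (∏ j, SymmetricAlgebra.ι k V (x j))) =
      ∑ j, of ρ f 1 (symMap a (∏ i ∈ Finset.Iio j, SymmetricAlgebra.ι k V (x i))) * δhat (x j) *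
        θ g • of ρ f g (symMap b (∏ i ∈ Finset.Ioi j, SymmetricAlgebra.ι k V (x i)))

lemma isDelta₁_iff {αhat : V ≃ₗ[k] V} {χα : G →* kˣ} {ςhat : V →ₗ[k] V} {χς : G → kˣ}
    {δhat : V →ₗ[k] CrossedProduct ρ f} {δ : CrossedProduct ρ f →ₗ[k] CrossedProduct ρ f} :
    IsDelta₁ (diagEquiv αhat χα) (diag ςhat χς) δhat δ ↔
      IsTwistedDelta αhat.toLinearMap ςhat (fun g => (χς g : k)) δhat δ := by
  have h : ∀ P, diagEquiv αhat χα (of ρ f 1 P) = of ρ f 1 (symMap αhat.toLinearMap P) := fun P => by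
    change diag αhat.toLinearMap χα (of ρ f 1 P) = _
    simp
  simp only [IsDelta₁, IsTwistedDelta, h, diag_of]

/-- The constant `χς 1` arises because `ς` is applied to an element `P w_1` on the left. It cannot
be dropped before `χς` is known to be a homomorphism. -/
lemma isDelta₂_iff {αhat : V ≃ₗ[k] V} {χα : G →* kˣ} {ςhat : V →ₗ[k] V} {χς : G → kˣ}
    {δhat : V →ₗ[k] CrossedProduct ρ f} {δ : CrossedProduct ρ f →ₗ[k] CrossedProduct ρ f} :
    IsDelta₂ (diagEquiv αhat χα).symm (diag ςhat χς) δhat δ ↔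
      IsTwistedDelta (ςhat ∘ₗ αhat.symm.toLinearMap) LinearMap.id (fun _ => (χς 1 : k)) δhat δ := by
  have h : ∀ P, (diagEquiv αhat χα).symm (of ρ f 1 P) =
      of ρ f 1 (symMap αhat.symm.toLinearMap P) := fun P => by
    change diag αhat.symm.toLinearMap (χα : G → kˣ)⁻¹ (of ρ f 1 P) = _
    simp
  simp only [IsDelta₂, IsTwistedDelta, h, diag_of, symMap_id, AlgHom.id_apply, symMap_comp_apply,
    smul_mul_assoc, mul_smul_comm]

lemma IsTwistedDelta.unique {a b : V →ₗ[k] V} {θ : G → k} {δhat : V →ₗ[k] CrossedProduct ρ f}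
    {δ δ' : CrossedProduct ρ f →ₗ[k] CrossedProduct ρ f} (h : IsTwistedDelta a b θ δhat δ)
    (h' : IsTwistedDelta a b θ δhat δ') : δ = δ' := by
  refine hom_ext fun g P => ?_
  suffices H : δ ∘ₗ of ρ f g = δ' ∘ₗ of ρ f g from LinearMap.congr_fun H P
  refine linearMap_ext_prod_ι fun m x => ?_
  rw [LinearMap.comp_apply, LinearMap.comp_apply, h, h']

lemma isTwistedDelta_of_twisted_derivation {a b : V →ₗ[k] V} {θ : G → k}
    {δhat : V →ₗ[k] CrossedProduct ρ f} {d : SymmetricAlgebra k V →ₗ[k] CrossedProduct ρ f}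
    (hd : ∀ P Q, d (P * Q) = d P * of ρ f 1 (symMap b Q) + of ρ f 1 (symMap a P) * d Q)
    (hv : ∀ v, d (SymmetricAlgebra.ι k V v) = δhat v)
    {δ : CrossedProduct ρ f →ₗ[k] CrossedProduct ρ f}
    (hδ : ∀ g P, δ (of ρ f g P) = d P * θ g • of ρ f g 1) :
    IsTwistedDelta a b θ δhat δ := by
  intro m x g
  rw [hδ, twisted_derivation_prod (a := (incl ρ f).comp (symMap a))
    (b := (incl ρ f).comp (symMap b)) hd, Finset.sum_mul]
  refine Finset.sum_congr rfl fun j _ => ?_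
  rw [AlgHom.comp_apply, AlgHom.comp_apply, incl_apply, incl_apply, hv, mul_assoc, mul_smul_comm,
    ← of_eq_mul]

/-- The factor `w_g` is merely carried along on the right, so existence involves no relation between
`V` and `G`, and `θ` may be any function. This gives well-definedness of `δ₁` and `δ₂` before they
are known to be skew derivations. -/
lemma exists_isTwistedDelta {a b : V →ₗ[k] V} (θ : G → k) {δhat : V →ₗ[k] CrossedProduct ρ f}
    (h : ∀ v w, of ρ f 1 (SymmetricAlgebra.ι k V (a v)) * δhat w +
        δhat v * of ρ f 1 (SymmetricAlgebra.ι k V (b w)) =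
      of ρ f 1 (SymmetricAlgebra.ι k V (a w)) * δhat v +
        δhat w * of ρ f 1 (SymmetricAlgebra.ι k V (b v))) :
    ∃ d : SymmetricAlgebra k V →ₗ[k] CrossedProduct ρ f,
      (∀ P Q, d (P * Q) = d P * of ρ f 1 (symMap b Q) + of ρ f 1 (symMap a P) * d Q) ∧
      (∀ v, d (SymmetricAlgebra.ι k V v) = δhat v) ∧
      IsTwistedDelta a b θ δhat
        (liftLin ρ f fun g => LinearMap.mulRight k (θ g • of ρ f g 1) ∘ₗ d) := by
  obtain ⟨d, hv, hd⟩ := exists_twisted_derivation ((incl ρ f).comp (symMap a))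
    ((incl ρ f).comp (symMap b)) δhat (by simpa using h)
  exact ⟨d, hd, hv, isTwistedDelta_of_twisted_derivation hd hv fun g P => by simp⟩

/-! ### Compatibility of the data with the relations of `S(V) #_f G` -/

section Relations

variable {δ : V →ₗ[k] CrossedProduct ρ f} {x : V} {S : Finset G} {P : G → SymmetricAlgebra k V}

/-- Compatibility with `v w = w v`. -/
lemma commutator_relation_of_ker {a b : V →ₗ[k] V}
    (hdec : ∀ v, ∃ c : k, v - c • x ∈ LinearMap.ker δ) (hδx : δ x = ∑ g ∈ S, of ρ f g (P g))
    (h : ∀ g ∈ S, ∀ u ∈ LinearMap.ker δ, a u = ρ g (b u)) (v w : V) :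
    of ρ f 1 (SymmetricAlgebra.ι k V (a v)) * δ w + δ v * of ρ f 1 (SymmetricAlgebra.ι k V (b w)) =
      of ρ f 1 (SymmetricAlgebra.ι k V (a w)) * δ v +
        δ w * of ρ f 1 (SymmetricAlgebra.ι k V (b v)) := by
  -- After splitting `v` and `w` along `ker δ` and `x`, pairs inside the kernel contribute zero and
  -- the pair `(x, x)` is symmetric, so only mixed pairs matter.
  have key : ∀ u ∈ LinearMap.ker δ, of ρ f 1 (SymmetricAlgebra.ι k V (a u)) * δ x =
      δ x * of ρ f 1 (SymmetricAlgebra.ι k V (b u)) := by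
    intro u hu
    rw [hδx, Finset.mul_sum, Finset.sum_mul]
    refine Finset.sum_congr rfl fun g hg => ?_
    rw [of_one_mul_of, of_mul_of_one, symMap_ι, h g hg u hu, mul_comm]
  obtain ⟨c, hc⟩ := hdec v
  obtain ⟨c', hc'⟩ := hdec w
  obtain ⟨u, hu, rfl⟩ : ∃ u ∈ LinearMap.ker δ, v = u + c • x := ⟨_, hc, by abel⟩
  obtain ⟨u', hu', rfl⟩ : ∃ u' ∈ LinearMap.ker δ, w = u' + c' • x := ⟨_, hc', by abel⟩
  have h1 := key u hu
  have h2 := key u' hu'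
  rw [LinearMap.mem_ker] at hu hu'
  simp only [map_add, map_smul, hu, hu', add_mul, mul_add, smul_mul_assoc, mul_smul_comm, zero_add,
    h1, h2]
  module

/-- For the pair `(u, x)` the coefficient of `w_g` reads `a(u) P_g = P_g ᵍb(u)`, and `P_g ≠ 0`
cancels since `S(V)` is a domain. -/
lemma eq_on_ker_of_commutator_relation {a b : V →ₗ[k] V}
    (hP : ∀ g ∈ S, P g ≠ 0) (hδx : δ x = ∑ g ∈ S, of ρ f g (P g))
    (h : ∀ v w, of ρ f 1 (SymmetricAlgebra.ι k V (a v)) * δ w +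
        δ v * of ρ f 1 (SymmetricAlgebra.ι k V (b w)) =
      of ρ f 1 (SymmetricAlgebra.ι k V (a w)) * δ v +
        δ w * of ρ f 1 (SymmetricAlgebra.ι k V (b v))) :
    ∀ g ∈ S, ∀ u ∈ LinearMap.ker δ, a u = ρ g (b u) := by
  intro g hg u hu
  have := h u x
  rw [LinearMap.mem_ker] at hu
  rw [hu, zero_mul, mul_zero, add_zero, zero_add, hδx, Finset.mul_sum, Finset.sum_mul] at this
  simp only [of_one_mul_of, of_mul_of_one, symMap_ι] at this
  have h2 := sum_of_injective this g hg
  rw [mul_comm] at h2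
  exact ι_injective (mul_left_cancel₀ (hP g hg) h2)

/-- Compatibility with `w_g v = ᵍv w_g`. -/
lemma group_relation_iff {η θ : G → kˣ} {lam : G → k}
    (hdec : ∀ v, ∃ c : k, v - c • x ∈ LinearMap.ker δ)
    (hP : ∀ g ∈ S, P g ≠ 0) (hδx : δ x = ∑ g ∈ S, of ρ f g (P g))
    (hlam : ∀ g, ρ g x - lam g • x ∈ LinearMap.ker δ) :
    (∀ g v, δ (ρ g v) * (θ g : k) • of ρ f g 1 = (η g : k) • of ρ f g 1 * δ v) ↔
      (∀ g, ∀ h ∈ S, g * h * g⁻¹ ∈ S) ∧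
      (∀ g, ∀ u ∈ LinearMap.ker δ, ρ g u ∈ LinearMap.ker δ) ∧
      (∀ g, ∀ h ∈ S, ((η g * f g h : kˣ) : k) • symMap (ρ g) (P h) =
        (lam g * (θ g * f (g * h * g⁻¹) g : kˣ)) • P (g * h * g⁻¹)) := by
  classical
  have hlam' : ∀ g, δ (ρ g x) = lam g • δ x := fun g => by
    rw [← sub_eq_zero, ← map_smul, ← map_sub]; exact hlam g
  have hL : ∀ g, δ (ρ g x) * (θ g : k) • of ρ f g 1 =
      ∑ h ∈ S, of ρ f (h * g) ((lam g * (θ g * f h g : kˣ)) • P h) := fun g => by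
    rw [hlam', hδx, smul_mul_assoc, Finset.sum_mul, Finset.smul_sum]
    refine Finset.sum_congr rfl fun h _ => ?_
    rw [mul_smul_comm, of_mul_of, map_one, mul_one, map_smul, map_smul, smul_smul, smul_smul,
      Units.val_mul, mul_assoc]
  have hR : ∀ g, (η g : k) • of ρ f g 1 * δ x =
      ∑ h ∈ S, of ρ f (g * h) (((η g * f g h : kˣ) : k) • symMap (ρ g) (P h)) := fun g => by
    rw [hδx, Finset.mul_sum]
    refine Finset.sum_congr rfl fun h _ => ?_
    rw [smul_mul_assoc, of_mul_of, one_mul, map_smul, map_smul, smul_smul, Units.val_mul]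
  -- The left-hand side is supported on the `w_{h'g}` with `h' ∈ S`; the equation `h' g = g h`
  -- forces `h' = g h g⁻¹`.
  have hcL : ∀ g h, coeff ρ f (g * h) (δ (ρ g x) * (θ g : k) • of ρ f g 1) =
      if g * h * g⁻¹ ∈ S then (lam g * (θ g * f (g * h * g⁻¹) g : kˣ)) • P (g * h * g⁻¹) else 0 := by
    intro g h
    rw [hL, map_sum]
    simp only [coeff_of, ← eq_mul_inv_iff_mul_eq]
    rw [Finset.sum_ite_eq']
  have hcR : ∀ g, ∀ h ∈ S, coeff ρ f (g * h) ((η g : k) • of ρ f g 1 * δ x) =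
      ((η g * f g h : kˣ) : k) • symMap (ρ g) (P h) := by
    intro g h hh
    rw [hR, map_sum]
    simp only [coeff_of, mul_right_inj]
    rw [Finset.sum_ite_eq', if_pos hh]
  constructor
  · intro H
    -- If `g h g⁻¹` were outside `S`, the left coefficient would be zero, while the right one is a
    -- nonzero multiple of `ᵍP_h ≠ 0`.
    have hS : ∀ g, ∀ h ∈ S, g * h * g⁻¹ ∈ S := by
      intro g h hh
      by_contra hn
      have := congrArg (coeff ρ f (g * h)) (H g x)
      rw [hcL, if_neg hn, hcR g h hh] at this
      refine hP h hh (symMap_injective (ρ.apply_bijective g) ?_)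
      rw [map_zero]
      exact (smul_eq_zero.mp this.symm).resolve_left (Units.ne_zero _)
    refine ⟨hS, fun g u hu => ?_, fun g h hh => ?_⟩
    · have := H g u
      rw [LinearMap.mem_ker.mp hu, mul_zero] at this
      -- Right multiplication by `w_{g⁻¹}` removes `w_g` up to the unit `f(g, g⁻¹)`.
      have h2 : (δ (ρ g u) * (θ g : k) • of ρ f g 1) * of ρ f g⁻¹ 1 = 0 := by rw [this, zero_mul]
      rw [mul_smul_comm, smul_mul_assoc, mul_assoc, of_mul_of, map_one, mul_one, mul_inv_cancel,
        map_smul, ← one_def, mul_smul_comm, smul_smul, mul_one] at h2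
      exact (smul_eq_zero.mp h2).resolve_left (mul_ne_zero (Units.ne_zero _) (Units.ne_zero _))
    · have := congrArg (coeff ρ f (g * h)) (H g x)
      rw [hcL, if_pos (hS g h hh), hcR g h hh] at this
      exact this.symm
  · rintro ⟨hS, hker, hPg⟩ g v
    have hx : δ (ρ g x) * (θ g : k) • of ρ f g 1 = (η g : k) • of ρ f g 1 * δ x := by
      rw [hL, hR]
      -- Conjugation by `g` permutes `S`; surjectivity uses stability under `g⁻¹`.
      refine (Finset.sum_bij (fun h _ => g * h * g⁻¹) (fun h hh => hS g h hh)
        (fun _ _ _ _ h => by simpa using h) (fun h hh => ⟨g⁻¹ * h * g, ?_, by group⟩)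
        (fun h hh => ?_)).symm
      · simpa using hS g⁻¹ h hh
      · rw [hPg g h hh, inv_mul_cancel_right]
    obtain ⟨c, hc⟩ := hdec v
    obtain ⟨u, hu, rfl⟩ : ∃ u ∈ LinearMap.ker δ, v = u + c • x := ⟨_, hc, by abel⟩
    have hgu := LinearMap.mem_ker.mp (hker g u hu)
    have hu := LinearMap.mem_ker.mp hu
    rw [map_add, map_add, map_add, hgu, hu, zero_add, zero_add, map_smul, map_smul, map_smul,
      smul_mul_assoc, hx, mul_smul_comm]

/-- Compatibility with a diagonal operator, up to a scalar `r`. -/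
lemma diag_relation_iff {c : V →ₗ[k] V} {χ : G → kˣ} {r κ : k}
    (hdec : ∀ v, ∃ c : k, v - c • x ∈ LinearMap.ker δ) (hδx : δ x = ∑ g ∈ S, of ρ f g (P g))
    (hκ : c x - κ • x ∈ LinearMap.ker δ) :
    (∀ v, δ (c v) = r • diag c χ (δ v)) ↔ (∀ u ∈ LinearMap.ker δ, c u ∈ LinearMap.ker δ) ∧
      ∀ g ∈ S, κ • P g = (r * χ g) • symMap c (P g) := by
  have hκ' : δ (c x) = κ • δ x := by
    rw [← sub_eq_zero, ← map_smul, ← map_sub]; exact hκ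
  have hL : δ (c x) = ∑ g ∈ S, of ρ f g (κ • P g) := by
    rw [hκ', hδx, Finset.smul_sum]
    exact Finset.sum_congr rfl fun g _ => (map_smul _ _ _).symm
  have hR : r • diag c χ (δ x) = ∑ g ∈ S, of ρ f g ((r * χ g) • symMap c (P g)) := by
    rw [hδx, map_sum, Finset.smul_sum]
    exact Finset.sum_congr rfl fun g _ => by rw [diag_of, map_smul, smul_smul]
  constructor
  · intro H
    refine ⟨fun u hu => ?_, ?_⟩
    · rw [LinearMap.mem_ker] at hu ⊢
      rw [H, hu, map_zero, smul_zero]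
    · have := H x
      rw [hL, hR] at this
      exact sum_of_injective this
  · rintro ⟨hker, hP⟩ v
    have hx : δ (c x) = r • diag c χ (δ x) := by
      rw [hL, hR]
      exact Finset.sum_congr rfl fun g hg => by rw [hP g hg]
    obtain ⟨s, hs⟩ := hdec v
    obtain ⟨u, hu, rfl⟩ : ∃ u ∈ LinearMap.ker δ, v = u + s • x := ⟨_, hs, by abel⟩
    have hcu := LinearMap.mem_ker.mp (hker u hu)
    have hu := LinearMap.mem_ker.mp hu
    rw [map_add, map_add, map_add, hcu, hu, zero_add, zero_add, map_smul, map_smul, map_smul,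
      map_smul, hx, smul_comm]

end Relations

/-! ### Skew derivations of `S(V) #_f G` -/

section SkewDer

variable {δ : V →ₗ[k] CrossedProduct ρ f} {a b : V →ₗ[k] V} {η θ : G → kˣ}
  {E : CrossedProduct ρ f →ₗ[k] CrossedProduct ρ f}

/-- The two sides are the Leibniz expansions of `E` at `v w = w v`, up to reordering of summands. -/
lemma IsSkewDer.commutator_relation (hη : η 1 = 1) (hθ : θ 1 = 1)
    (hE : IsSkewDer (diag a η) (diag b θ) E)
    (hv : ∀ v, E (of ρ f 1 (SymmetricAlgebra.ι k V v)) = δ v) (v w : V) :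
    of ρ f 1 (SymmetricAlgebra.ι k V (a v)) * δ w + δ v * of ρ f 1 (SymmetricAlgebra.ι k V (b w)) =
      of ρ f 1 (SymmetricAlgebra.ι k V (a w)) * δ v +
        δ w * of ρ f 1 (SymmetricAlgebra.ι k V (b v)) := by
  have key : ∀ v w, E (of ρ f 1 (SymmetricAlgebra.ι k V v * SymmetricAlgebra.ι k V w)) =
      of ρ f 1 (SymmetricAlgebra.ι k V (a v)) * δ w +
        δ v * of ρ f 1 (SymmetricAlgebra.ι k V (b w)) := fun v w => by
    rw [← of_one_mul_of, hE, hv, hv, diag_of, diag_of, hη, hθ, symMap_ι, symMap_ι, Units.val_one,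
      one_smul, one_smul, add_comm]
  rw [← key, ← key, mul_comm]

lemma IsSkewDer.group_relation (hE : IsSkewDer (diag a η) (diag b θ) E)
    (hv : ∀ v, E (of ρ f 1 (SymmetricAlgebra.ι k V v)) = δ v) (hg : ∀ g, E (of ρ f g 1) = 0)
    (g : G) (v : V) :
    δ (ρ g v) * (θ g : k) • of ρ f g 1 = (η g : k) • of ρ f g 1 * δ v := by
  have := congrArg E (of_comm_ι (ρ := ρ) (f := f) g v)
  rw [hE, hE, hg, zero_mul, zero_add, mul_zero, add_zero, hv, hv, diag_of, diag_of, map_one (symMap a),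
    map_one (symMap b)] at this
  exact this.symm

/-- Identifies the operators of `D₁` and `D₂` in a module algebra with the explicitly defined `δ₁`
and `δ₂`. -/
lemma IsSkewDer.isTwistedDelta (hη : η 1 = 1) (hθ : θ 1 = 1)
    (hE : IsSkewDer (diag a η) (diag b θ) E)
    (hv : ∀ v, E (of ρ f 1 (SymmetricAlgebra.ι k V v)) = δ v) (hg : ∀ g, E (of ρ f g 1) = 0) :
    IsTwistedDelta a b (fun g => (θ g : k)) δ E := by
  refine isTwistedDelta_of_twisted_derivation (d := E ∘ₗ of ρ f 1) (fun P Q => ?_) hv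
    (fun g P => ?_)
  · rw [LinearMap.comp_apply, ← of_one_mul_of, hE, diag_of, diag_of, hη, hθ, Units.val_one,
      one_smul, one_smul]
    rfl
  · rw [of_eq_mul, hE, hg, mul_zero, add_zero, diag_of, map_one (symMap b)]
    rfl

/-- A map `δ` as in the theorem is a skew derivation when the data are compatible with the
relations. -/
lemma IsTwistedDelta.isSkewDer {η θ : G →* kˣ} (ha : ∀ g v, a (ρ g v) = ρ g (a v))
    (hb : ∀ g v, b (ρ g v) = ρ g (b v)) (hE : IsTwistedDelta a b (fun g => (θ g : k)) δ E)
    (hcomm : ∀ v w, of ρ f 1 (SymmetricAlgebra.ι k V (a v)) * δ w +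
        δ v * of ρ f 1 (SymmetricAlgebra.ι k V (b w)) =
      of ρ f 1 (SymmetricAlgebra.ι k V (a w)) * δ v +
        δ w * of ρ f 1 (SymmetricAlgebra.ι k V (b v)))
    (hG : ∀ g v, δ (ρ g v) * (θ g : k) • of ρ f g 1 = (η g : k) • of ρ f g 1 * δ v) :
    IsSkewDer (diag a η) (diag b θ) E := by
  -- The formula determines `E`, so `E` may be replaced by the map built from a twisted derivation
  -- of `S(V)`.
  obtain ⟨d, hd, hv, hδ⟩ := exists_isTwistedDelta (fun g => (θ g : k)) hcomm
  rw [hE.unique hδ]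
  exact isSkewDer_liftLin ha hb hd (by simpa only [hv] using hG)

lemma IsTwistedDelta.apply_ι {θ : G → k} (hθ : θ 1 = 1) (hE : IsTwistedDelta a b θ δ E) (v : V) :
    E (of ρ f 1 (SymmetricAlgebra.ι k V v)) = δ v := by
  have := hE 1 (fun _ => v) 1
  have h1 : Finset.Iio (0 : Fin 1) = ∅ := by ext i; simp
  have h2 : Finset.Ioi (0 : Fin 1) = ∅ := by ext i; simp
  simpa [hθ, h1, h2, ← one_def] using this

lemma IsTwistedDelta.apply_of_one {θ : G → k} (hE : IsTwistedDelta a b θ δ E) (g : G) :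
    E (of ρ f g 1) = 0 := by
  simpa using hE 0 Fin.elim0 g

/-- A skew derivation vanishing on the `w_g` commutes up to a scalar with a diagonal automorphism
if it does so on `V`. -/
lemma IsSkewDer.comp_diag {c : V →ₗ[k] V} (hc : ∀ g v, c (ρ g v) = ρ g (c v)) {χ : G →* kˣ} {r : k}
    {η θ : G →* kˣ} (ha : ∀ g v, a (ρ g v) = ρ g (a v)) (hb : ∀ g v, b (ρ g v) = ρ g (b v))
    (hE : IsSkewDer (diag a η) (diag b θ) E)
    (hv : ∀ v, E (of ρ f 1 (SymmetricAlgebra.ι k V v)) = δ v) (hg : ∀ g, E (of ρ f g 1) = 0)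
    (hac : ∀ v, a (c v) = c (a v)) (hbc : ∀ v, b (c v) = c (b v))
    (h : ∀ v, δ (c v) = r • diag c χ (δ v)) (y : CrossedProduct ρ f) :
    E (diag c χ y) = r • diag c χ (E y) := by
  let T := diagHom ρ f c hc χ
  let φ := diagHom ρ f a ha η
  let ψ := diagHom ρ f b hb θ
  have hT : ∀ y, diag c χ y = T y := fun _ => rfl
  have comm : ∀ (a : V →ₗ[k] V) (ha : ∀ g v, a (ρ g v) = ρ g (a v)) (η : G →* kˣ),
      (∀ v, a (c v) = c (a v)) →
      ∀ y, diagHom ρ f a ha η (T y) = T (diagHom ρ f a ha η y) := fun a ha η hac y => by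
    suffices H : (diagHom ρ f a ha η).comp T = T.comp (diagHom ρ f a ha η) from
      DFunLike.congr_fun H y
    refine CrossedProduct.algHom_ext (fun v => ?_) (fun g => ?_)
    · simp [T, hac]
    · simp [T, smul_smul, mul_comm]
  suffices H : E ∘ₗ T.toLinearMap = r • (T.toLinearMap ∘ₗ E) from LinearMap.congr_fun H y
  -- Since `T` commutes with `φ` and `ψ`, both `E T` and `r T E` are `(φ T, ψ T)`-skew derivations,
  -- hence comparable on generators.
  refine isSkewDer_ext (φ := φ.comp T) (ψ := ψ.comp T) (fun y z => ?_) (fun y z => ?_)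
    (fun v => ?_) (fun g => ?_)
  · change E (T (y * z)) = _
    rw [map_mul, hE]
    rfl
  · change r • T (E (y * z)) = r • T (E y) * ψ (T z) + φ (T y) * r • T (E z)
    rw [hE, map_add, map_mul, map_mul, comm a ha η hac, comm b hb θ hbc, smul_add, smul_mul_assoc,
      mul_smul_comm]
    rfl
  · change E (T _) = r • T (E _)
    rw [hv, ← hT, ← hT, ← h, diag_of, map_one χ, Units.val_one, one_smul, symMap_ι, hv]
  · change E (T _) = r • T (E _)
    rw [hg, map_zero, smul_zero, ← hT, diag_of, map_one (symMap c), map_smul, hg, smul_zero]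

end SkewDer

end Crossed

/-- The commutator of two skew derivations as in an `H_q`-module algebra. -/
lemma IsSkewDer.commutator {k : Type u} [Field k] {A : Type v} [Ring A] [Algebra k A] {q : k}
    {α : A ≃ₗ[k] A} {T D₁ D₂ : A →ₗ[k] A} (hD₁ : IsSkewDer α.toLinearMap T D₁)
    (hD₂ : IsSkewDer (T ∘ₗ α.symm.toLinearMap) LinearMap.id D₂)
    (hα₁ : ∀ y, D₁ (α y) = α (D₁ y)) (hα₂ : ∀ y, D₂ (α y) = α (D₂ y))
    (hT₁ : ∀ y, D₁ (T y) = q • T (D₁ y)) (hT₂ : ∀ y, D₂ (T y) = q • T (D₂ y))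
    (hTα : ∀ y, T (α y) = α (T y)) : IsSkewDer T T (D₁ ∘ₗ D₂ - D₂ ∘ₗ D₁) := by
  intro y z
  have hα₁' : ∀ y, D₁ (α.symm y) = α.symm (D₁ y) := fun y => by
    rw [LinearEquiv.eq_symm_apply, ← hα₁, LinearEquiv.apply_symm_apply]
  change D₁ (D₂ (y * z)) - D₂ (D₁ (y * z)) = (D₁ (D₂ y) - D₂ (D₁ y)) * T z +
    T y * (D₁ (D₂ z) - D₂ (D₁ z))
  rw [hD₁, hD₂, map_add, map_add, hD₁, hD₁, hD₂, hD₂]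
  -- The cross terms cancel in pairs: `α(D₂ y) D₁ z` against `D₂(α y) D₁ z`, and `D₁(T α⁻¹ y) T(D₂
  -- z)` against `T α⁻¹(D₁ y) D₂(T z)`. In the second pair each term picks up exactly one factor
  -- `q`.
  simp only [LinearMap.comp_apply, LinearMap.id_apply, LinearEquiv.coe_coe, hα₂, hT₁, hT₂,
    ← hTα, hα₁', LinearEquiv.apply_symm_apply, LinearEquiv.symm_apply_apply, mul_sub,
    sub_mul, smul_mul_assoc, mul_smul_comm]
  abel

/-! ### Conversion of the conditions to coefficient form -/

section Crossed

variable {k : Type u} [Field k] {G : Type v} [Group G] {V : Type w} [AddCommGroup V] [Module k V]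
  {ρ : Representation k G V} {f : NormalCocycle k G}

open CrossedProduct

lemma exists_sub_smul_mem_of_finrank_quotient {K : Submodule k V}
    (hK : Module.finrank k (V ⧸ K) = 1) {x : V} (hx : x ∉ K) (v : V) :
    ∃ c : k, v - c • x ∈ K := by
  have hne : K.mkQ x ≠ 0 := by simpa using hx
  obtain ⟨c, hc⟩ := (finrank_eq_one_iff_of_nonzero' _ hne).mp hK (K.mkQ v)
  refine ⟨c, ?_⟩
  rw [← Submodule.ker_mkQ K, LinearMap.mem_ker, map_sub, map_smul, hc, sub_self]

lemma eq_biUnion_conjClasses_iff (S : Finset G) :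
    (∃ C : Set (ConjClasses G), (S : Set G) = ⋃ c ∈ C, c.carrier) ↔
      ∀ g, ∀ h ∈ S, g * h * g⁻¹ ∈ S := by
  constructor
  · rintro ⟨C, hC⟩ g h hh
    have mem : ∀ a, a ∈ S ↔ ConjClasses.mk a ∈ C := fun a => by
      rw [← Finset.mem_coe, hC]
      simp [ConjClasses.mem_carrier_iff_mk_eq]
    rw [mem] at hh ⊢
    rwa [show ConjClasses.mk (g * h * g⁻¹) = ConjClasses.mk h from
      ConjClasses.mk_eq_mk_iff_isConj.mpr (isConj_iff.mpr ⟨g, rfl⟩).symm]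
  · intro H
    refine ⟨ConjClasses.mk '' S, ?_⟩
    ext a
    simp only [Finset.mem_coe, Set.mem_iUnion, ConjClasses.mem_carrier_iff_mk_eq, Set.mem_image,
      exists_prop]
    constructor
    · exact fun ha => ⟨_, ⟨a, ha, rfl⟩, rfl⟩
    · rintro ⟨_, ⟨b, hb, rfl⟩, hab⟩
      obtain ⟨g, hg⟩ := isConj_iff.mp (ConjClasses.mk_eq_mk_iff_isConj.mp hab.symm)
      exact hg ▸ H g b hb

/-- Passes between the equivariance conditions solved for `ᵍP_h` and the form with scalars on both
sides that comparing coefficients yields. -/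
lemma units_smul_eq_iff {M : Type*} [AddCommGroup M] [Module k M] {u w z : kˣ} (h : z = u⁻¹ * w)
    {l : k} {X Y : M} : (u : k) • X = (l * w) • Y ↔ X = (l * z) • Y := by
  have : (l * (w : k)) = u * (l * (z : k)) := by
    rw [h, Units.val_mul, mul_left_comm, Units.mul_inv_cancel_left]
  rw [this, mul_smul]
  exact (smul_right_injective M u.ne_zero).eq_iff

/-- The same passage for the eigenvector conditions, with `r = q` for `ς` and `r = 1` for `α`. -/
lemma diag_of_one_eq_smul_iff {c : V →ₗ[k] V} {χ : G → kˣ} (hχ : χ 1 = 1) (r : kˣ) {κ : k} (g : G)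
    (X : SymmetricAlgebra k V) :
    diag c χ (of ρ f 1 X) = (((r⁻¹ : kˣ) : k) * κ * ((χ g)⁻¹ : kˣ)) • of ρ f 1 X ↔
      κ • X = (r * χ g : k) • symMap c X := by
  have : κ = (r * χ g : k) * (((r⁻¹ : kˣ) : k) * κ * ((χ g)⁻¹ : kˣ)) := by
    rw [Units.val_inv_eq_inv_val, Units.val_inv_eq_inv_val]
    field_simp
  conv_rhs => rw [this, mul_smul]
  rw [(smul_right_injective _ (mul_ne_zero r.ne_zero (χ g).ne_zero)).eq_iff, diag_of, hχ,
    Units.val_one, one_smul, ← map_smul, (of_injective 1).eq_iff, eq_comm]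

lemma diag_comp_diag (a b : V →ₗ[k] V) (η θ : G → kˣ) :
    (diag a η ∘ₗ diag b θ : CrossedProduct ρ f →ₗ[k] CrossedProduct ρ f) =
      diag (a ∘ₗ b) (η * θ) :=
  hom_ext fun g P => by simp [symMap_comp_apply, smul_smul, mul_comm]

lemma diag_comp_diag_comm {a b : V →ₗ[k] V} (η θ : G → kˣ) (h : ∀ v, a (b v) = b (a v)) :
    (diag a η ∘ₗ diag b θ : CrossedProduct ρ f →ₗ[k] CrossedProduct ρ f) =
      diag b θ ∘ₗ diag a η := by
  rw [diag_comp_diag, diag_comp_diag, mul_comm η, show a ∘ₗ b = b ∘ₗ a from LinearMap.ext h]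

lemma diag_id_one : (diag LinearMap.id 1 : CrossedProduct ρ f →ₗ[k] CrossedProduct ρ f) =
    LinearMap.id :=
  hom_ext fun g P => by simp [symMap_id]

end Crossed

end BraidedHq

end

/-! ### The criterion -/

open BraidedHq BraidedHq.CrossedProduct
set_option maxHeartbeats 400000 in
theorem mainTheorem7 {k : Type*} [Field k] (q : kˣ)
    {G : Type*} [Group G] {V : Type*} [AddCommGroup V] [Module k V] [FiniteDimensional k V]
    (ρ : Representation k G V) (f : NormalCocycle k G)
    -- the data defining `α` and the good transposition `s`
    (αhat : V ≃ₗ[k] V) (hαhat : ∀ g v, αhat (ρ g v) = ρ g (αhat v)) (χα : G →* kˣ)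
    -- the data of the prescribed action
    (χς : G → kˣ) (ςhat : V →ₗ[k] V) (δhat : Fin 2 → V →ₗ[k] CrossedProduct ρ f)
    (hcodim : ∀ i, Module.finrank k (V ⧸ LinearMap.ker (δhat i)) = 1)
    (hker : LinearMap.ker (δhat 0) ≠ LinearMap.ker (δhat 1))
    (x : Fin 2 → V) (hx : ∀ i, x i ∉ LinearMap.ker (δhat i))
    (hx01 : x 0 ∈ LinearMap.ker (δhat 1)) (hx10 : x 1 ∈ LinearMap.ker (δhat 0))
    -- `S i = {g_{i1}, …, g_{in_i}}` and the polynomials `P i g` for `g ∈ S i`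
    (S : Fin 2 → Finset G) (P : Fin 2 → G → SymmetricAlgebra k V)
    (hP : ∀ i, ∀ g ∈ S i, P i g ≠ 0)
    (hδx : ∀ i, δhat i (x i) = ∑ g ∈ S i, of ρ f g (P i g))
    -- the scalars `λ_{ig}`, `ω_i`, `ν_i`
    (lam : Fin 2 → G → k) (ω ν : Fin 2 → k)
    (hlam : ∀ i g, ρ g (x i) - lam i g • x i ∈ LinearMap.ker (δhat i))
    (hω : ∀ i, ςhat (x i) - ω i • x i ∈ LinearMap.ker (δhat i))
    (hν : ∀ i, αhat (x i) - ν i • x i ∈ LinearMap.ker (δhat i)) :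
    let α : CrossedProduct ρ f ≃ₗ[k] CrossedProduct ρ f := diagEquiv αhat χα
    let ς : CrossedProduct ρ f →ₗ[k] CrossedProduct ρ f := diag ςhat χς
    let condς : Prop :=
      (∀ g ∈ S 0, ∀ v ∈ LinearMap.ker (δhat 0), ςhat v = ρ g⁻¹ (αhat v)) ∧
      (∀ g ∈ S 1, ∀ v ∈ LinearMap.ker (δhat 1), ςhat v = ρ g (αhat v))
    let condα : Prop :=
      ∀ i, (LinearMap.ker (δhat i)).map αhat.toLinearMap = LinearMap.ker (δhat i)
    -- the maps `δ₁`, `δ₂` of the criterion are well defined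
    (condς → condα → (∃! δ, IsDelta₁ α ς (δhat 0) δ) ∧ (∃! δ, IsDelta₂ α.symm ς (δhat 1) δ)) ∧
    -- the criterion
    ((∃ act : Hq k q →ₐ[k] Module.End k (CrossedProduct ρ f),
        IsModuleAlgebra (goodTransposition q α) act ∧
        (∀ v, act (Hq.sigma k q) (of ρ f 1 (SymmetricAlgebra.ι k V v)) =
          of ρ f 1 (SymmetricAlgebra.ι k V (ςhat v))) ∧
        (∀ g, act (Hq.sigma k q) (of ρ f g 1) = (χς g : k) • of ρ f g 1) ∧
        (∀ i v, act (Hq.D k q i) (of ρ f 1 (SymmetricAlgebra.ι k V v)) = δhat i v) ∧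
        (∀ i g, act (Hq.D k q i) (of ρ f g 1) = 0)) ↔
      -- `ςhat` is bijective and `k[G]`-linear, `χς` is a group homomorphism
      (Function.Bijective ςhat ∧ (∀ g v, ςhat (ρ g v) = ρ g (ςhat v)) ∧
        (∀ g h, χς (g * h) = χς g * χς h)) ∧
      -- `ςhat` on the two kernels
      condς ∧
      -- the sets `S i` are unions of conjugacy classes
      (∀ i, ∃ C : Set (ConjClasses G), (S i : Set G) = ⋃ c ∈ C, c.carrier) ∧
      -- the kernels are `G`-submodules
      (∀ i g, ∀ v ∈ LinearMap.ker (δhat i), ρ g v ∈ LinearMap.ker (δhat i)) ∧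
      -- twisted equivariance of the polynomials `P 0 h`
      (∀ g, ∀ h ∈ S 0, symMap (ρ g) (P 0 h) =
        (lam 0 g * ((χα g)⁻¹ * χς g * (f g h)⁻¹ * f (g * h * g⁻¹) g : kˣ)) •
          P 0 (g * h * g⁻¹)) ∧
      -- twisted equivariance of the polynomials `P 1 h`
      (∀ g, ∀ h ∈ S 1, symMap (ρ g) (P 1 h) =
        (lam 1 g * (χα g * (χς g)⁻¹ * (f g h)⁻¹ * f (g * h * g⁻¹) g : kˣ)) •
          P 1 (g * h * g⁻¹)) ∧
      -- `αhat` preserves the kernels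
      condα ∧
      -- the polynomials are eigenvectors of `ς` and `α`
      (∀ i, ∀ g ∈ S i,
        ς (of ρ f 1 (P i g)) = (((q⁻¹ : kˣ) : k) * ω i * ((χς g)⁻¹ : kˣ)) • of ρ f 1 (P i g) ∧
        α (of ρ f 1 (P i g)) = (ν i * ((χα g)⁻¹ : kˣ)) • of ρ f 1 (P i g)) ∧
      -- the kernel conditions and, at roots of unity, the nilpotency of `δ₁` and `δ₂`
      (∃ δ₁ δ₂ : CrossedProduct ρ f →ₗ[k] CrossedProduct ρ f,
        IsDelta₁ α ς (δhat 0) δ₁ ∧ IsDelta₂ α.symm ς (δhat 1) δ₂ ∧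
        δ₂ (∑ g ∈ S 0, of ρ f g (P 0 g)) = 0 ∧ δ₁ (∑ g ∈ S 1, of ρ f g (P 1 g)) = 0 ∧
        (∀ l : ℕ, 2 ≤ l → IsPrimitiveRoot q l →
          (δ₁ : Module.End k (CrossedProduct ρ f)) ^ l = 0 ∧
          (δ₂ : Module.End k (CrossedProduct ρ f)) ^ l = 0))) := by
  intro α ς condς condα
  have hdec : ∀ i v, ∃ c : k, v - c • x i ∈ LinearMap.ker (δhat i) := fun i =>
    exists_sub_smul_mem_of_finrank_quotient (hcodim i) (hx i)
  have hαker : condα → ∀ i, ∀ u ∈ LinearMap.ker (δhat i), αhat u ∈ LinearMap.ker (δhat i) :=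
    fun h i u hu => h i ▸ Submodule.mem_map_of_mem hu
  have hαsymm : condα → ∀ i, ∀ u ∈ LinearMap.ker (δhat i),
      αhat.symm u ∈ LinearMap.ker (δhat i) := by
    intro h i u hu
    rw [← h i] at hu
    obtain ⟨v, hv, rfl⟩ := hu
    simpa using hv
  -- Both parts of `condς` take the common form `a u = ᵍb(u)`, with `(a, b) = (α̂, ς̂)` for `D₁` and
  -- `(ς̂ α̂⁻¹, id)` for `D₂`. The second needs the kernel to be stable under `α̂⁻¹`.
  have rel₀ : condς → ∀ g ∈ S 0, ∀ u ∈ LinearMap.ker (δhat 0),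
      αhat.toLinearMap u = ρ g (ςhat u) := fun h g hg u hu => by
    rw [h.1 g hg u hu, Representation.self_inv_apply]; rfl
  have rel₁ : condς → condα → ∀ g ∈ S 1, ∀ u ∈ LinearMap.ker (δhat 1),
      (ςhat ∘ₗ αhat.symm.toLinearMap) u = ρ g (LinearMap.id (R := k) u) := fun h h' g hg u hu => by
    rw [LinearMap.comp_apply, LinearEquiv.coe_coe, h.2 g hg _ (hαsymm h' 1 u hu),
      LinearEquiv.apply_symm_apply, LinearMap.id_apply]
  refine ⟨fun hς hα => ?_, ?_⟩
  · simp only [isDelta₁_iff, isDelta₂_iff, α, ς]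
    obtain ⟨d, -, -, h₁⟩ := exists_isTwistedDelta (fun g => (χς g : k))
      (commutator_relation_of_ker (hdec 0) (hδx 0) (rel₀ hς))
    obtain ⟨e, -, -, h₂⟩ := exists_isTwistedDelta (fun _ => (χς 1 : k))
      (commutator_relation_of_ker (hdec 1) (hδx 1) (rel₁ hς hα))
    exact ⟨⟨_, h₁, fun _ h => h.unique h₁⟩, ⟨_, h₂, fun _ h => h.unique h₂⟩⟩
  -- The pair `(η, θ)` will be `(χα, χς)` for `D₁` and `(χς χα⁻¹, 1)` for `D₂`.
  have hgrp₀ := fun η θ => group_relation_iff (η := η) (θ := θ) (hdec 0) (hP 0) (hδx 0) (hlam 0)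
  have hgrp₁ := fun η θ => group_relation_iff (η := η) (θ := θ) (hdec 1) (hP 1) (hδx 1) (hlam 1)
  have hdiagα := fun i => diag_relation_iff (χ := χα) (r := 1) (hdec i) (hδx i) (hν i)
  have hdiagς := fun i => diag_relation_iff (χ := χς) (r := q) (hdec i) (hδx i) (hω i)
  have hcond₅ : ∀ g, ∀ h, symMap (ρ g) (P 0 h) =
        (lam 0 g * ((χα g)⁻¹ * χς g * (f g h)⁻¹ * f (g * h * g⁻¹) g : kˣ)) •
          P 0 (g * h * g⁻¹) ↔ ((χα g * f g h : kˣ) : k) • symMap (ρ g) (P 0 h) =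
        (lam 0 g * (χς g * f (g * h * g⁻¹) g : kˣ)) • P 0 (g * h * g⁻¹) := fun g h =>
    (units_smul_eq_iff (by rw [mul_inv]; ac_rfl)).symm
  have hcond₆ : ∀ g, ∀ h, symMap (ρ g) (P 1 h) =
        (lam 1 g * (χα g * (χς g)⁻¹ * (f g h)⁻¹ * f (g * h * g⁻¹) g : kˣ)) •
          P 1 (g * h * g⁻¹) ↔ (((χς * (χα : G → kˣ)⁻¹) g * f g h : kˣ) : k) • symMap (ρ g) (P 1 h) =
        (lam 1 g * ((1 : G → kˣ) g * f (g * h * g⁻¹) g : kˣ)) • P 1 (g * h * g⁻¹) := fun g h =>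
    (units_smul_eq_iff (by
      rw [Pi.mul_apply, Pi.inv_apply, Pi.one_apply, one_mul, mul_inv, mul_inv, inv_inv]
      ac_rfl)).symm
  have hςα : (ς ∘ₗ α.symm.toLinearMap) =
      diag (ςhat ∘ₗ αhat.symm.toLinearMap) (χς * (χα : G → kˣ)⁻¹) := diag_comp_diag _ _ _ _
  constructor
  · rintro ⟨act, H, hσv, hσg, hDv, hDg⟩
    have hT1 := H.sigma_one
    have hTm := H.sigma_mul
    -- Apply `σ` to `w_g w_h = f(g, h) w_{gh}` and cancel the cocycle value.
    have hmul : ∀ g h, χς (g * h) = χς g * χς h := by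
      intro g h
      have := hTm (of ρ f g 1) (of ρ f h 1)
      simp only [of_mul_of, map_one, mul_one, map_smul, hσg, smul_mul_assoc, mul_smul_comm,
        smul_smul] at this
      have hne : of ρ f (g * h) 1 ≠ 0 := fun h0 => one_ne_zero (of_injective _ (h0.trans (map_zero _).symm))
      have h2 := smul_left_injective k hne this
      refine Units.ext (mul_left_cancel₀ (f g h).ne_zero (h2.trans ?_))
      rw [Units.val_mul]
      ring
    have hχ1 : χς 1 = 1 := map_one (MonoidHom.mk' χς hmul)
    have hlin : ∀ g v, ςhat (ρ g v) = ρ g (ςhat v) := by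
      intro g v
      have := congrArg (act (Hq.sigma k q)) (of_comm_ι (ρ := ρ) (f := f) g v)
      rw [hTm, hTm, hσv, hσv, hσg, smul_mul_assoc, mul_smul_comm, of_comm_ι, of_one_mul_of,
        of_one_mul_of, mul_one, mul_one] at this
      exact ι_injective (of_injective g (smul_right_injective _ (χς g).ne_zero this.symm))
    have hσ : act (Hq.sigma k q) = ς := by
      have : AlgHom.ofLinearMap (act (Hq.sigma k q)) hT1 hTm =
          diagHom ρ f ςhat hlin (MonoidHom.mk' χς hmul) := by
        refine CrossedProduct.algHom_ext (fun v => ?_) (fun g => ?_)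
        · simp [hσv, hχ1]
        · simp [hσg]
      exact congrArg AlgHom.toLinearMap this
    -- The action of `σ⁻¹` undoes that of `σ`. Surjectivity then follows from finite dimension.
    have hςinj : Function.Injective ςhat := by
      intro v w hvw
      have h2 : act (Hq.sigma k q) (of ρ f 1 (SymmetricAlgebra.ι k V v)) =
          act (Hq.sigma k q) (of ρ f 1 (SymmetricAlgebra.ι k V w)) := by rw [hσv, hσv, hvw]
      have h3 := congrArg (act (Hq.sigmaInv k q)) h2
      rw [← Module.End.mul_apply, ← Module.End.mul_apply, ← map_mul, Hq.sigmaInv_mul_sigma,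
        map_one, Module.End.one_apply, Module.End.one_apply] at h3
      exact ι_injective (of_injective 1 h3)
    have hD₀ : act (Hq.D k q 0) ≠ 0 := fun h0 => hx 0 (by
      rw [LinearMap.mem_ker, ← hDv, h0, LinearMap.zero_apply])
    have hcomm := H.commute hD₀
    have hE₀ : IsSkewDer (diag αhat.toLinearMap χα) (diag ςhat χς) (act (Hq.D k q 0)) :=
      fun y z => by rw [H.isSkewDer_D_zero, hσ]; rfl
    have hE₁ : IsSkewDer (diag (ςhat ∘ₗ αhat.symm.toLinearMap) (χς * (χα : G → kˣ)⁻¹))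
        (diag LinearMap.id 1) (act (Hq.D k q 1)) := by
      rw [← hςα, diag_id_one, ← hσ]
      exact H.isSkewDer_D_one
    have hη₁ : (χς * (χα : G → kˣ)⁻¹) 1 = 1 := by simp [hχ1]
    have hαδ : ∀ i v, δhat i (αhat v) = (1 : k) • diag αhat.toLinearMap χα (δhat i v) := by
      intro i v
      rw [← hDv, ← hDv, one_smul]
      refine Eq.trans ?_ (hcomm _ _)
      congr 1
      change _ = diag αhat.toLinearMap χα _
      simp
    have hςδ : ∀ i v, δhat i (ςhat v) = (q : k) • diag ςhat χς (δhat i v) := by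
      intro i v
      rw [← hDv, ← hDv, ← hσv, ← Module.End.mul_apply, ← map_mul, Hq.D_mul_sigma, map_smul,
        map_mul, hσ]
      rfl
    have hg₀ := (hgrp₀ χα χς).1 (hE₀.group_relation (hDv 0) (hDg 0))
    have hg₁ := (hgrp₁ _ _).1 (hE₁.group_relation (hDv 1) (hDg 1))
    have hαδ' := fun i => (hdiagα i).1 (hαδ i)
    have hςδ' := fun i => (hdiagς i).1 (hςδ i)
    -- Commutation with `α` gives one inclusion; injectivity of `α` on `A` gives the other.
    have hα : condα := by
      intro i
      refine le_antisymm (Submodule.map_le_iff_le_comap.mpr (hαδ' i).1) fun u hu => ?_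
      refine ⟨αhat.symm u, ?_, αhat.apply_symm_apply u⟩
      have := hαδ i (αhat.symm u)
      rw [LinearEquiv.apply_symm_apply, LinearMap.mem_ker.mp hu, one_smul] at this
      exact α.map_eq_zero_iff.mp this.symm
    have hr₀ := eq_on_ker_of_commutator_relation (hP 0) (hδx 0)
      (hE₀.commutator_relation (map_one χα) hχ1 (hDv 0))
    have hr₁ := eq_on_ker_of_commutator_relation (hP 1) (hδx 1)
      (hE₁.commutator_relation hη₁ rfl (hDv 1))
    have hd₁ : IsDelta₁ α ς (δhat 0) (act (Hq.D k q 0)) :=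
      isDelta₁_iff.mpr (hE₀.isTwistedDelta (map_one χα) hχ1 (hDv 0) (hDg 0))
    have hd₂ : IsDelta₂ α.symm ς (δhat 1) (act (Hq.D k q 1)) := by
      refine isDelta₂_iff.mpr ?_
      simpa only [hχ1, Pi.one_apply] using hE₁.isTwistedDelta hη₁ rfl (hDv 1) (hDg 1)
    have hDD : ∀ y, act (Hq.D k q 0) (act (Hq.D k q 1) y) =
        act (Hq.D k q 1) (act (Hq.D k q 0) y) := fun y => by
      rw [← Module.End.mul_apply, ← map_mul, Hq.D_comm, map_mul, Module.End.mul_apply]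
    refine ⟨⟨⟨hςinj, LinearMap.injective_iff_surjective.mp hςinj⟩, hlin, hmul⟩,
      ⟨fun g hg v hv => ?_, fun g hg v hv => ?_⟩, fun i => ?_, fun i => ?_,
      fun g h hh => (hcond₅ g h).mpr (hg₀.2.2 g h hh),
      fun g h hh => (hcond₆ g h).mpr (hg₁.2.2 g h hh), hα, fun i g hg => ⟨?_, ?_⟩,
      act (Hq.D k q 0), act (Hq.D k q 1), hd₁, hd₂, ?_, ?_, fun l hl hq => ⟨?_, ?_⟩⟩
    · rw [show αhat v = ρ g (ςhat v) from hr₀ g hg v hv, Representation.inv_self_apply]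
    · simpa using hr₁ g hg _ (hαker hα 1 v hv)
    · rw [eq_biUnion_conjClasses_iff]
      match i with
      | 0 => exact hg₀.1
      | 1 => exact hg₁.1
    · match i with
      | 0 => exact hg₀.2.1
      | 1 => exact hg₁.2.1
    · exact (diag_of_one_eq_smul_iff hχ1 q g _).mpr ((hςδ' i).2 g hg)
    · have := (diag_of_one_eq_smul_iff (ρ := ρ) (f := f) (map_one χα) 1 g _).mpr ((hαδ' i).2 g hg)
      rwa [inv_one, Units.val_one, one_mul] at this
    -- `D₂ D₁ x₁ = D₁ D₂ x₁ = 0`, because `x₁` lies in the kernel of `δ̂₂`.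
    · rw [← hδx, ← hDv, ← hDD, hDv, LinearMap.mem_ker.mp hx01, map_zero]
    · rw [← hδx, ← hDv, hDD, hDv, LinearMap.mem_ker.mp hx10, map_zero]
    · rw [← map_pow, Hq.D_pow k q 0 hl hq, map_zero]
    · rw [← map_pow, Hq.D_pow k q 1 hl hq, map_zero]
  · rintro ⟨⟨hbij, hlin, hmul⟩, hς, hC, hsub, h₅, h₆, hα, h₉, δ₁, δ₂, hδ₁, hδ₂, h₈, h₈', h₁₀⟩
    let χ : G →* kˣ := MonoidHom.mk' χς hmul
    have hχ1 : χς 1 = 1 := map_one χ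
    have hconj := fun i => (eq_biUnion_conjClasses_iff (S i)).mp (hC i)
    have hd₁ := isDelta₁_iff.mp hδ₁
    have hd₂ : IsTwistedDelta (ςhat ∘ₗ αhat.symm.toLinearMap) LinearMap.id
        (fun g => ((1 : G →* kˣ) g : k)) (δhat 1) δ₂ := by
      have := isDelta₂_iff.mp hδ₂
      rw [hχ1] at this
      exact this
    have hv₁ := hd₁.apply_ι (by rw [hχ1, Units.val_one])
    have hv₂ := hd₂.apply_ι rfl
    have hg₁ := hd₁.apply_of_one
    have hg₂ := hd₂.apply_of_one
    have hαhat' : ∀ g v, αhat.symm (ρ g v) = ρ g (αhat.symm v) := fun g v => by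
      rw [LinearEquiv.symm_apply_eq, hαhat, LinearEquiv.apply_symm_apply]
    have hE₀ : IsSkewDer (diag αhat.toLinearMap χα) (diag ςhat χ) δ₁ :=
      IsTwistedDelta.isSkewDer (θ := χ) hαhat hlin hd₁
        (commutator_relation_of_ker (hdec 0) (hδx 0) (rel₀ hς))
        ((hgrp₀ χα χς).2 ⟨hconj 0, hsub 0, fun g h hh => (hcond₅ g h).mp (h₅ g h hh)⟩)
    have hςαlin : ∀ g v, (ςhat ∘ₗ αhat.symm.toLinearMap) (ρ g v) =
        ρ g ((ςhat ∘ₗ αhat.symm.toLinearMap) v) := fun g v => by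
      simp [hαhat', hlin]
    have hE₁ : IsSkewDer (diag (ςhat ∘ₗ αhat.symm.toLinearMap) (χ * χα⁻¹ : G →* kˣ))
        (diag LinearMap.id (1 : G →* kˣ)) δ₂ :=
      IsTwistedDelta.isSkewDer hςαlin (fun _ _ => rfl) hd₂
        (commutator_relation_of_ker (hdec 1) (hδx 1) (rel₁ hς hα))
        ((hgrp₁ _ _).2 ⟨hconj 1, hsub 1, fun g h hh => (hcond₆ g h).mp (h₆ g h hh)⟩)
    -- Some `g` is needed to exploit `condς`; one exists because `δ̂ᵢ(xᵢ) ≠ 0`.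
    have hne : ∀ i, (S i).Nonempty := fun i => by
      rw [Finset.nonempty_iff_ne_empty]
      intro h0
      have := hδx i
      rw [h0, Finset.sum_empty] at this
      exact hx i this
    -- On each kernel `ς̂` is `α̂` followed by a group element, and both preserve the kernel.
    have hςker : ∀ i, ∀ u ∈ LinearMap.ker (δhat i), ςhat u ∈ LinearMap.ker (δhat i) := by
      intro i u hu
      obtain ⟨g, hg⟩ := hne i
      match i with
      | 0 => rw [hς.1 g hg u hu]; exact hsub 0 _ _ (hαker hα 0 u hu)
      | 1 => rw [hς.2 g hg u hu]; exact hsub 1 _ _ (hαker hα 1 u hu)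
    -- On each kernel `ς̂` agrees with a group element composed with `α̂`, which commutes with `α̂`.
    -- The two kernels span `V`, since `x₁` lies in the second and spans a complement of the first.
    have hςα' : ∀ v, ςhat (αhat v) = αhat (ςhat v) := by
      have h0 : ∀ u ∈ LinearMap.ker (δhat 0), ςhat (αhat u) = αhat (ςhat u) := fun u hu => by
        obtain ⟨g, hg⟩ := hne 0
        rw [hς.1 g hg _ (hαker hα 0 u hu), hς.1 g hg u hu, hαhat]
      have h1 : ∀ u ∈ LinearMap.ker (δhat 1), ςhat (αhat u) = αhat (ςhat u) := fun u hu => by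
        obtain ⟨g, hg⟩ := hne 1
        rw [hς.2 g hg _ (hαker hα 1 u hu), hς.2 g hg u hu, hαhat]
      intro v
      obtain ⟨c, hc⟩ := hdec 0 v
      have h2 := h0 _ hc
      simp only [map_sub, map_smul, h1 _ hx01] at h2
      exact sub_left_injective h2
    have hςα'' : ∀ v, αhat.symm (ςhat v) = ςhat (αhat.symm v) := fun v => by
      rw [LinearEquiv.symm_apply_eq, ← hςα', LinearEquiv.apply_symm_apply]
    have hαδ : ∀ i v, δhat i (αhat v) = (1 : k) • diag αhat.toLinearMap χα (δhat i v) := fun i =>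
      (hdiagα i).2 ⟨hαker hα i, fun g hg => by
        refine (diag_of_one_eq_smul_iff (ρ := ρ) (f := f) (map_one χα) 1 g _).mp ?_
        rw [inv_one, Units.val_one, one_mul]
        exact (h₉ i g hg).2⟩
    have hςδ : ∀ i v, δhat i (ςhat v) = (q : k) • diag ςhat χ (δhat i v) := fun i =>
      (hdiagς i).2 ⟨hςker i, fun g hg =>
        (diag_of_one_eq_smul_iff (ρ := ρ) (f := f) hχ1 q g _).mp (h₉ i g hg).1⟩
    have hα₁ : ∀ y, δ₁ (α y) = α (δ₁ y) := fun y => by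
      refine (hE₀.comp_diag hαhat hαhat hlin hv₁ hg₁ (fun _ => rfl) hςα' (hαδ 0) y).trans ?_
      rw [one_smul]; rfl
    have hα₂ : ∀ y, δ₂ (α y) = α (δ₂ y) := fun y => by
      refine (hE₁.comp_diag hαhat hςαlin (fun _ _ => rfl) hv₂ hg₂ (fun v => ?_) (fun _ => rfl)
        (hαδ 1) y).trans ?_
      · simp [← hςα']
      · rw [one_smul]; rfl
    have hς₁ : ∀ y, δ₁ (ς y) = (q : k) • ς (δ₁ y) :=
      hE₀.comp_diag (χ := χ) (r := q) hlin hαhat hlin hv₁ hg₁ (fun v => (hςα' v).symm) (fun _ => rfl) (hςδ 0)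
    have hς₂ : ∀ y, δ₂ (ς y) = (q : k) • ς (δ₂ y) :=
      hE₁.comp_diag (χ := χ) (r := q) hlin hςαlin (fun _ _ => rfl) hv₂ hg₂ (fun v => by simp [hςα''])
        (fun _ => rfl) (hςδ 1)
    have hαm : ∀ y z, α (y * z) = α y * α z := map_mul (diagHom ρ f αhat.toLinearMap hαhat χα)
    have hα1 : α 1 = 1 := map_one (diagHom ρ f αhat.toLinearMap hαhat χα)
    have hςm : ∀ y z, ς (y * z) = ς y * ς z := map_mul (diagHom ρ f ςhat hlin χ)
    have hς1 : ς 1 = 1 := map_one (diagHom ρ f ςhat hlin χ)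
    have hςα₁ : ∀ y, ς (α y) = α (ς y) := by
      intro y
      exact LinearMap.congr_fun (diag_comp_diag_comm (a := ςhat) (b := αhat.toLinearMap) χς χα hςα') y
    have hD₀ : IsSkewDer α.toLinearMap ς δ₁ := hE₀
    have hD₁ : IsSkewDer (ς ∘ₗ α.symm.toLinearMap) LinearMap.id δ₂ := by
      rw [hςα]
      intro y z
      have h : (diag LinearMap.id ⇑(1 : G →* kˣ) : CrossedProduct ρ f →ₗ[k] CrossedProduct ρ f) z =
        z := LinearMap.congr_fun diag_id_one z
      rw [hE₁ y z, h]
      rfl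
    have hδδ : δ₁ ∘ₗ δ₂ = δ₂ ∘ₗ δ₁ := by
      rw [← sub_eq_zero]
      refine isSkewDer_ext (φ := diagHom ρ f ςhat hlin χ) (ψ := diagHom ρ f ςhat hlin χ)
        (fun y z => ?_) (fun y z => by simp) (fun v => ?_) (fun g => ?_)
      · exact hD₀.commutator hD₁ hα₁ hα₂ hς₁ hς₂ hςα₁ y z
      -- Both sides vanish: each `δ̂ᵢ(v)` is a multiple of `δ̂ᵢ(xᵢ)`, which the other map kills by
      -- assumption.
      · have h0 : ∀ v, δ₁ (δhat 1 v) = δ₂ (δhat 0 v) := by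
          intro v
          obtain ⟨c, hc⟩ := hdec 0 v
          obtain ⟨c', hc'⟩ := hdec 1 v
          have e0 : δhat 0 v = c • δhat 0 (x 0) := by
            rw [← sub_eq_zero, ← map_smul, ← map_sub]; exact hc
          have e1 : δhat 1 v = c' • δhat 1 (x 1) := by
            rw [← sub_eq_zero, ← map_smul, ← map_sub]; exact hc'
          rw [e0, e1, map_smul, map_smul, hδx, hδx, h₈, h₈', smul_zero, smul_zero]
        rw [LinearMap.sub_apply, LinearMap.comp_apply, LinearMap.comp_apply, hv₁, hv₂, h0, sub_self,
          LinearMap.zero_apply]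
      · rw [LinearMap.sub_apply, LinearMap.comp_apply, LinearMap.comp_apply, hg₁, hg₂, map_zero,
          map_zero, sub_self, LinearMap.zero_apply]
    -- Bijectivity of `ς̂` makes `ς` invertible; its inverse is the operator of `σ⁻¹`.
    let τ : CrossedProduct ρ f ≃ₗ[k] CrossedProduct ρ f :=
      diagEquiv (LinearEquiv.ofBijective ςhat hbij) χς
    have hτ : τ.toLinearMap = ς := rfl
    obtain ⟨act, hσ, hA₀, hA₁⟩ : ∃ act : Hq k q →ₐ[k] Module.End k (CrossedProduct ρ f),
        act (Hq.sigma k q) = ς ∧ act (Hq.D k q 0) = δ₁ ∧ act (Hq.D k q 1) = δ₂ := by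
      refine ⟨Hq.lift ![δ₁, δ₂] ς τ.symm.toLinearMap hδδ (LinearMap.ext τ.apply_symm_apply)
        (LinearMap.ext τ.symm_apply_apply) ?_ ?_, Hq.lift_sigma .., Hq.lift_D .., Hq.lift_D ..⟩
      · intro i
        match i with
        | 0 => exact LinearMap.ext hς₁
        | 1 => exact LinearMap.ext hς₂
      · intro i l hl hq
        match i with
        | 0 => exact (h₁₀ l hl hq).1
        | 1 => exact (h₁₀ l hl hq).2
    refine ⟨act, isModuleAlgebra_of_isSkewDer hα1 hαm ?_ ?_ ?_ ?_ ?_ ?_, ?_, ?_, ?_, ?_⟩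
    · rw [hσ]; exact hς1
    · rw [hσ]; exact hςm
    · rw [hσ]; exact hςα₁
    · intro i
      match i with
      | 0 => rw [hA₀]; exact hα₁
      | 1 => rw [hA₁]; exact hα₂
    · rw [hσ, hA₀]; exact hD₀
    · rw [hσ, hA₁]; exact hD₁
    · intro v
      rw [hσ, diag_of, hχ1, Units.val_one, one_smul, symMap_ι]
    · intro g
      rw [hσ, diag_of, map_one]
    · intro i v
      match i with
      | 0 => rw [hA₀, hv₁]
      | 1 => rw [hA₁, hv₂]
    · intro i g
      match i with
      | 0 => rw [hA₀, hg₁]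
      | 1 => rw [hA₁, hg₂]
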